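/- **Setting.** Let $n,m,s\ge 0$. Let $N=\mathbb C^{2n}\times T^*\mathbb R^m$ with points $x=(z_1,z_2,p,q)$, $z_1,z_2\in\mathbb C^n$, $p,q\in\mathbb R^m$, carry the canonical symplectic form $\omega_N$ in which $q$ and the imaginary parts of the complex coordinates are positions, and $p$ and their real parts the conjugate momenta: $$\omega_N(u,v)=\sum_{k=1}^{2}\sum_{j=1}^n \operatorname{Im}\big(u_{z_k^j}\overline{v_{z_k^j}}\big)+\sum_{i=1}^m\big(u_{q_i}v_{p_i}-u_{p_i}v_{q_i}\big).$$ The Hamiltonian vector field $X_K$ of $K$ is given by $\omega_N(X_K,\cdot)=\mathrm dK$. Let $P=\mathbb R^{3n}\times T^*\mathbb R^m$ with points $(w,p,q)$, $w=(w_1,\dots,w_n)$, $w_j\in\mathbb R^3$, carry the Poisson bracket $$\{f,g\}=\sum_{i=1}^m\Big(\frac{\partial f}{\partial q_i}\frac{\partial g}{\partial p_i}-\frac{\partial f}{\partial p_i}\frac{\partial g}{\partial q_i}\Big)+\sum_{j=1}^n\Big\langle w_j,\frac{\partial f}{\partial w_j}\times\frac{\partial g}{\partial w_j}\Big\rangle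 ,$$ whose symplectic leaves are the sets $\{\|w_j\|=r_j\ \text{for all } j\}$, $r_j\ge 0$. Let $M=S_2^n\times T^*\mathbb R^m\subset P$ be the leaf $\{\|w_j\|=1\ \text{for all } j\}$, with the symplectic form $\sum_i \mathrm dq_i\wedge \mathrm dp_i$ plus the sum of the area forms $(u,v)\mapsto\langle w_j,u_j\times v_j\rangle$ of the spheres. Let $\psi:N\to P$ be $\psi(z_1,z_2,p,q)=(J(z_1^1,z_2^1),\dots,J(z_1^n,z_2^n),p,q)$ with the Hopf map $$J(z_1,z_2)=\tfrac14\big(2\operatorname{Re}(z_1\bar z_2),\,2\operatorname{Im}(z_1\bar z_2),\,|z_1|^2-|z_2|^2\big).$$ **Method.** Take an $s$-stage partitioned Runge–Kutta method on $N$ with coefficients $(a^z,b^z)$ for $z=(z_1,z_2)$, $(a^p,b^p)$ for $p$ and $(a^q,b^q)$ for $q$. For a vector field $f$ on an open set $\Omega\subset N$ and a step size $h\in\mathbb R$, the stages $Y_1,\dots,Y_s\in\Omega$ and the update $\tilde x$ of $x$ are given, in each component $c\in\{z,p,q\}$, by $$Y_i^c=x^c+h\sum_j a^c_{ij}f^c(Y_j),\qquad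 \tilde x^c=x^c+h\sum_i b_i^cf^c(Y_i).$$ By an *integrator* for $f$ with step $h$ on a set $V$ we mean an update map $\Phi:V\to N$, $x\mapsto\tilde x$, defined by stages $Y_i=Y_i(x)\in\Omega$ that solve the stage equations, depend continuously on $x\in V$, and at which the linearization of the stage equations with respect to the stages is invertible. **Theorem.** Assume that the following hold for all $i,j$. * $z$ is integrated with a symplectic Runge–Kutta method: $b^z_ib^z_j=b^z_ia^z_{ij}+b^z_ja^z_{ji}$. * $(p,q)$ is integrated with a symplectic partitioned Runge–Kutta method: $b^p_ib^q_j=b^p_ia^q_{ij}+b^q_ja^p_{ji}$ and $b^p_i=b^q_i$. * The $b$-coefficients of the two methods coincide: $b^z_i=b^q_i$. Let $1\le r\le\infty$. 1. Let $K$ be a Hamiltonian of class $C^{r+1}$ on an open set $\Omega\subset N$, $h\in\mathbb R$, and $\Phi$ an integrator for $X_K$ with step $h$ on an open set $V\subset N$. Then $\Phi$ is of class $C^r$ and symplectic on $V$. 2. Let $H$ be a Hamiltonian of class $C^{r+1}$ on an open set $U\subset P$, and consider the pulled-back system $X_{H\circ\psi}$ on $\psi^{-1}(U)$. (a) For every compact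 $C\subset U$ and every $\varepsilon>0$ there is $h_0>0$ such that for all $|h|<h_0$ there are an open set $W\subset P$ containing $C$ and an integrator for $X_{H\circ\psi}$ with step $h$ on $\psi^{-1}(W)$ all of whose stages satisfy $\operatorname{dist}(Y_i(x),x)<\varepsilon$. (b) Let $h\in\mathbb R$, $W\subset P$ open, and let $\Phi$ be any integrator for $X_{H\circ\psi}$ with step $h$ on $\psi^{-1}(W)$ (symplectic by 1). Then $\Phi$ descends to a map $\varphi:W\to P$ with $\varphi\circ\psi=\psi\circ\Phi$ on $\psi^{-1}(W)$. The map $\varphi$ is of class $C^r$, is a Poisson map, and maps each point to a point of the same symplectic leaf of $P$. In particular $\varphi$ maps $M\cap W$ into $M$, and its restriction $M\cap W\to M$ is symplectic. -/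

import Mathlib

open scoped Matrix

noncomputable section

namespace CollectiveSymplectic

/-! ### The spaces `N`, `P`, `M` and the map `ψ : N → P` -/

/-- `N = ℂ²ⁿ × T*ℝᵐ`; a point is `(z₁, z₂, p, q)` with `z₁, z₂ ∈ ℂⁿ` and `p, q ∈ ℝᵐ`. -/
abbrev SpaceN (n m : ℕ) : Type :=
  (Fin n → ℂ) × (Fin n → ℂ) × (Fin m → ℝ) × (Fin m → ℝ)

/-- `P = ℝ³ⁿ × T*ℝᵐ`; a point is `(w, p, q)` with `w = (w₁, …, wₙ)`, `wⱼ ∈ ℝ³`, and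
`p, q ∈ ℝᵐ`. -/
abbrev SpaceP (n m : ℕ) : Type :=
  (Fin n → Fin 3 → ℝ) × (Fin m → ℝ) × (Fin m → ℝ)

/-- The Hopf map `J : ℂ × ℂ → ℝ³`. -/
def hopf (z₁ z₂ : ℂ) : Fin 3 → ℝ :=
  ![(2 * (z₁ * star z₂).re) / 4, (2 * (z₁ * star z₂).im) / 4,
    (Complex.normSq z₁ - Complex.normSq z₂) / 4]

/-- The realization `ψ : N → P`: `n` copies of the Hopf map, and the identity on `T*ℝᵐ`. -/
def realization {n m : ℕ} (x : SpaceN n m) : SpaceP n m :=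
  (fun j => hopf (x.1 j) (x.2.1 j), x.2.2.1, x.2.2.2)

/-- `M = S₂ⁿ × T*ℝᵐ`, as a subset of `P`: all the `wⱼ` are Euclidean unit vectors. -/
def spaceM (n m : ℕ) : Set (SpaceP n m) :=
  {y | ∀ j, y.1 j ⬝ᵥ y.1 j = 1}

/-- The tangent space of `M` at `y ∈ M`, as a set of vectors in `P`. -/
def tangentM {n m : ℕ} (y : SpaceP n m) : Set (SpaceP n m) :=
  {u | ∀ j, y.1 j ⬝ᵥ u.1 j = 0}

/-! ### Symplectic and Poisson structures -/

/-- The canonical symplectic form on `N = ℂ²ⁿ × T*ℝᵐ`, that is `∑ d(position) ∧ d(momentum)`.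
On the complex coordinates, momenta are real parts and positions are imaginary parts
(this is the orientation of `ℂ² = T*ℝ²` for which the Hopf map is Poisson). -/
def omegaN {n m : ℕ} (u v : SpaceN n m) : ℝ :=
  (∑ j, ((u.1 j).im * (v.1 j).re - (u.1 j).re * (v.1 j).im))
    + (∑ j, ((u.2.1 j).im * (v.2.1 j).re - (u.2.1 j).re * (v.2.1 j).im))
    + ∑ i, (u.2.2.2 i * v.2.2.1 i - u.2.2.1 i * v.2.2.2 i)

/-- The Hamiltonian vector field of `K : N → ℝ` for `omegaN`:
`(position)' = ∂K/∂(momentum)`, `(momentum)' = -∂K/∂(position)`. -/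
def hamVectorField {n m : ℕ} (K : SpaceN n m → ℝ) (x : SpaceN n m) : SpaceN n m :=
  (fun j => ⟨-fderiv ℝ K x (Pi.single j Complex.I, 0, 0, 0),
      fderiv ℝ K x (Pi.single j 1, 0, 0, 0)⟩,
   fun j => ⟨-fderiv ℝ K x (0, Pi.single j Complex.I, 0, 0),
      fderiv ℝ K x (0, Pi.single j 1, 0, 0)⟩,
   fun i => -fderiv ℝ K x (0, 0, 0, Pi.single i 1),
   fun i => fderiv ℝ K x (0, 0, Pi.single i 1, 0))

/-- The gradient `∂f/∂wⱼ ∈ ℝ³` of a function on `P`. -/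
def gradW {n m : ℕ} (f : SpaceP n m → ℝ) (y : SpaceP n m) (j : Fin n) : Fin 3 → ℝ :=
  fun k => fderiv ℝ f y (Pi.single j (Pi.single k 1), 0, 0)

/-- `∂f/∂pᵢ` for a function on `P`. -/
def partialP {n m : ℕ} (f : SpaceP n m → ℝ) (y : SpaceP n m) (i : Fin m) : ℝ :=
  fderiv ℝ f y (0, Pi.single i 1, 0)

/-- `∂f/∂qᵢ` for a function on `P`. -/
def partialQ {n m : ℕ} (f : SpaceP n m → ℝ) (y : SpaceP n m) (i : Fin m) : ℝ :=
  fderiv ℝ f y (0, 0, Pi.single i 1)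

/-- The Poisson bracket on `P`: the canonical bracket on `T*ℝᵐ` plus
`∑ⱼ ⟨wⱼ, ∂f/∂wⱼ × ∂g/∂wⱼ⟩`. -/
def poissonBracket {n m : ℕ} (f g : SpaceP n m → ℝ) (y : SpaceP n m) : ℝ :=
  (∑ i, (partialQ f y i * partialP g y i - partialP f y i * partialQ g y i))
    + ∑ j, y.1 j ⬝ᵥ (gradW f y j ⨯₃ gradW g y j)

/-- The symplectic form of `M` at `y`, for tangent vectors `u, v` of `M` at `y`: the canonical
form of `T*ℝᵐ` plus the sum of the area forms `(u, v) ↦ ⟨wⱼ, uⱼ × vⱼ⟩` of the unit spheres. -/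
def omegaM {n m : ℕ} (y u v : SpaceP n m) : ℝ :=
  (∑ i, (u.2.2 i * v.2.1 i - u.2.1 i * v.2.2 i)) + ∑ j, y.1 j ⬝ᵥ (u.1 j ⨯₃ v.1 j)

/-- `Φ` is symplectic on the open set `V ⊆ N`: its differential preserves `omegaN`. -/
def IsSymplecticOnN {n m : ℕ} (Φ : SpaceN n m → SpaceN n m) (V : Set (SpaceN n m)) : Prop :=
  ∀ x ∈ V, DifferentiableAt ℝ Φ x ∧
    ∀ u v, omegaN (fderiv ℝ Φ x u) (fderiv ℝ Φ x v) = omegaN u v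

/-- `φ` is a Poisson map on the open set `W ⊆ P`. -/
def IsPoissonOnP {n m : ℕ} (φ : SpaceP n m → SpaceP n m) (W : Set (SpaceP n m)) : Prop :=
  ∀ y ∈ W, DifferentiableAt ℝ φ y ∧
    ∀ f g : SpaceP n m → ℝ, DifferentiableAt ℝ f (φ y) → DifferentiableAt ℝ g (φ y) →
      poissonBracket (f ∘ φ) (g ∘ φ) y = poissonBracket f g (φ y)

/-- `φ` maps every point of `W` to a point of the same symplectic leaf of `P`; the leaves are
the sets on which every `‖wⱼ‖` is constant. -/
def PreservesLeavesOn {n m : ℕ} (φ : SpaceP n m → SpaceP n m) (W : Set (SpaceP n m)) : Prop :=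
  ∀ y ∈ W, ∀ j, (φ y).1 j ⬝ᵥ (φ y).1 j = y.1 j ⬝ᵥ y.1 j

/-- `φ`, defined on the open set `W ⊆ P`, restricts to a symplectic map from the open subset
`M ∩ W` of `M` to `M`. -/
def RestrictsToSymplecticOnM {n m : ℕ} (φ : SpaceP n m → SpaceP n m)
    (W : Set (SpaceP n m)) : Prop :=
  ∀ y ∈ spaceM n m ∩ W, φ y ∈ spaceM n m ∧ DifferentiableAt ℝ φ y ∧
    (∀ u ∈ tangentM y, fderiv ℝ φ y u ∈ tangentM (φ y)) ∧
    ∀ u ∈ tangentM y, ∀ v ∈ tangentM y,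
      omegaM (φ y) (fderiv ℝ φ y u) (fderiv ℝ φ y v) = omegaM y u v

/-! ### Partitioned Runge–Kutta methods -/

/-- The coefficients of an `s`-stage Runge–Kutta method. -/
structure RKTableau (s : ℕ) where
  a : Fin s → Fin s → ℝ
  b : Fin s → ℝ

/-- The coefficient condition for a symplectic Runge–Kutta method. -/
def RKTableau.IsSymplectic {s : ℕ} (T : RKTableau s) : Prop :=
  ∀ i j, T.b i * T.b j = T.b i * T.a i j + T.b j * T.a j i

/-- The coefficient condition for a symplectic partitioned Runge–Kutta method which integrates
`q` with the tableau `Tq` and `p` with the tableau `Tp`. -/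
def IsSymplecticPair {s : ℕ} (Tp Tq : RKTableau s) : Prop :=
  (∀ i j, Tp.b i * Tq.b j = Tp.b i * Tq.a i j + Tq.b j * Tp.a j i) ∧ ∀ i, Tq.b i = Tp.b i

/-- A partitioned Runge–Kutta method on `N`: one tableau for each of `z = (z₁, z₂)`, `p`, `q`. -/
structure PRKMethod (s : ℕ) where
  tz : RKTableau s
  tp : RKTableau s
  tq : RKTableau s

/-- Multiply the `z`-, `p`- and `q`-component of `v ∈ N` by `α`, `β`, `γ`. -/
def scaleN {n m : ℕ} (α β γ : ℝ) (v : SpaceN n m) : SpaceN n m :=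
  (α • v.1, α • v.2.1, β • v.2.2.1, γ • v.2.2.2)

/-- Right-hand side of the stage equations `Y_i = x + h ∑ⱼ a_ij f(Y_j)`, where the coefficients
depend on the component. -/
def PRKMethod.stageMap {s n m : ℕ} (T : PRKMethod s) (h : ℝ) (f : SpaceN n m → SpaceN n m)
    (x : SpaceN n m) (Y : Fin s → SpaceN n m) : Fin s → SpaceN n m :=
  fun i => x + h • ∑ j, scaleN (T.tz.a i j) (T.tp.a i j) (T.tq.a i j) (f (Y j))

/-- The update `x̃ = x + h ∑ᵢ b_i f(Y_i)`, where the coefficients depend on the component. -/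
def PRKMethod.update {s n m : ℕ} (T : PRKMethod s) (h : ℝ) (f : SpaceN n m → SpaceN n m)
    (x : SpaceN n m) (Y : Fin s → SpaceN n m) : SpaceN n m :=
  x + h • ∑ i, scaleN (T.tz.b i) (T.tp.b i) (T.tq.b i) (f (Y i))

/-- One step of the (in general implicit) method is well defined on `V`, with stage values
`Y x`: for `x ∈ V` the stages `Y x` lie in the domain `Ω` of the vector field `f`, depend
continuously on `x`, solve the stage equations, and are a regular solution: the stage equations,
linearized in the stages, are uniquely solvable. The integrator is then the map
`x ↦ T.update h f x (Y x)` on `V`. -/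
structure PRKMethod.IsIntegrator {s n m : ℕ} (T : PRKMethod s) (h : ℝ)
    (f : SpaceN n m → SpaceN n m) (Ω V : Set (SpaceN n m))
    (Y : SpaceN n m → Fin s → SpaceN n m) : Prop where
  continuousOn : ContinuousOn Y V
  mem_domain : ∀ x ∈ V, ∀ i, Y x i ∈ Ω
  stage_eq : ∀ x ∈ V, Y x = T.stageMap h f x (Y x)
  regular : ∀ x ∈ V, Function.Bijective
    (fderiv ℝ (fun S : Fin s → SpaceN n m => S - T.stageMap h f x S) (Y x))

end CollectiveSymplectic

end

open CollectiveSymplectic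

/-!
For a symplectic tableau, or pair of tableaux, the update and the stages of two sequences satisfy a
discrete Leibniz rule for every bilinear form which pairs the two integrated components. Applied to
`ω_N` and the differentiated stage equations it reduces the symplecticity of the integrator to the
identity `ω_N(DX_K u, v) + ω_N(u, DX_K v) = 0` at the stages; applied to `|z₁|² + |z₂|²`, which is
constant along a pulled-back Hamiltonian vector field, it shows that the leaves are preserved.

Identify `(z₁, z₂)` with a quaternion. Then `X_{H ∘ ψ}(x) = g(ψ(x)) · x` with imaginary quaternions
`g(y)` built from `dH(y)`, and the fibres of `ψ` are the orbits of the torus acting from the other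
side. The field is torus-equivariant, and so are the stages: both `Y(t · x)` and `t · Y(x)` are
continuous families of regular solutions of the same stage equations over the connected torus which
agree at `t = 1`. Hence the integrator descends to `φ`.

The map `ψ` has no smooth local sections where some `w_j` vanishes, so the smoothness of `φ` is not
inherited from `Φ` directly. But the stages can be written `Y_i = c_i · x`, where the quaternions
`c_i` satisfy stage equations over `P` which involve `x` only through `ψ(x)`. The `c_i` can be
chosen such that these equations are regular at them, even though `x` need not be invertible, and
the implicit function theorem makes them smooth functions of `ψ(x)`.
-/

noncomputable section

namespace CollectiveSymplectic

open Filter Topology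

variable {n m s : ℕ}

section InverseFunction

variable {𝕜 E F X : Type*} [RCLike 𝕜] [NormedAddCommGroup E] [NormedSpace 𝕜 E] [CompleteSpace E]
  [NormedAddCommGroup F] [NormedSpace 𝕜 F] [CompleteSpace F]

lemma isInvertible_of_bijective {L : E →L[𝕜] F} (h : Function.Bijective L) : L.IsInvertible :=
  ⟨ContinuousLinearEquiv.ofBijective L (LinearMap.ker_eq_bot.2 h.1) (LinearMap.range_eq_top.2 h.2),
    rfl⟩

lemma eventuallyEq_of_comp_eventuallyEq {g : E → F} {a : E} (hg : ContDiffAt 𝕜 1 g a)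
    (hreg : Function.Bijective (fderiv 𝕜 g a)) {l : Filter X} {y₁ y₂ : X → E}
    (h₁ : Tendsto y₁ l (𝓝 a)) (h₂ : Tendsto y₂ l (𝓝 a)) (h : g ∘ y₁ =ᶠ[l] g ∘ y₂) :
    y₁ =ᶠ[l] y₂ := by
  obtain ⟨e, he⟩ := isInvertible_of_bijective hreg
  have hs : HasStrictFDerivAt g (e : E →L[𝕜] F) a := he ▸ hg.hasStrictFDerivAt one_ne_zero
  have hinv := hs.eventually_left_inverse
  filter_upwards [h₁.eventually hinv, h₂.eventually hinv, h] with x hx₁ hx₂ hx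
  rw [← hx₁, ← hx₂]
  exact congrArg _ hx

lemma eq_of_comp_eq_of_preconnectedSpace [TopologicalSpace X] [PreconnectedSpace X] {g : E → F}
    {y₁ y₂ : X → E} (hg : ∀ t, ContDiffAt 𝕜 1 g (y₁ t))
    (hreg : ∀ t, Function.Bijective (fderiv 𝕜 g (y₁ t))) (h₁ : Continuous y₁) (h₂ : Continuous y₂)
    (h : g ∘ y₁ = g ∘ y₂) {t₀ : X} (ht₀ : y₁ t₀ = y₂ t₀) : y₁ = y₂ := by
  have hopen : IsOpen {t | y₁ t = y₂ t} := isOpen_iff_mem_nhds.2 fun t ht =>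
    eventuallyEq_of_comp_eventuallyEq (hg t) (hreg t) (h₁.tendsto t)
      (ht ▸ h₂.tendsto t) h.eventuallyEq
  have huniv := IsClopen.eq_univ ⟨isClosed_eq h₁ h₂, hopen⟩ ⟨t₀, ht₀⟩
  exact funext fun t => huniv.ge (Set.mem_univ t)

lemma contDiffAt_of_comp_contDiffAt [NormedAddCommGroup X] [NormedSpace 𝕜 X]
    {g : E → F} {y : X → E} {x₀ : X} {r : WithTop ℕ∞}
    (hr : r ≠ 0) (hg : ContDiffAt 𝕜 r g (y x₀)) (hreg : Function.Bijective (fderiv 𝕜 g (y x₀)))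
    (hy : ContinuousAt y x₀) (hgy : ContDiffAt 𝕜 r (g ∘ y) x₀) :
    ContDiffAt 𝕜 r y x₀ := by
  obtain ⟨e, he⟩ := isInvertible_of_bijective hreg
  have hd : HasFDerivAt g (e : E →L[𝕜] F) (y x₀) := he ▸ (hg.differentiableAt hr).hasFDerivAt
  have hinv := (hg.hasStrictFDerivAt' hd hr).eventually_left_inverse
  refine ((hg.to_localInverse hd hr).comp x₀ hgy).congr_of_eventuallyEq ?_
  filter_upwards [hy.eventually hinv] with x hx
  exact hx.symm

lemma exists_contDiffAt_implicit [NormedAddCommGroup X] [NormedSpace 𝕜 X] [CompleteSpace X]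
    {G : X → E → F} {x₀ : X} {y₀ : E} {r : WithTop ℕ∞} (hr : r ≠ 0)
    (hG : ContDiffAt 𝕜 r (Function.uncurry G) (x₀, y₀))
    (hreg : Function.Bijective (fderiv 𝕜 (G x₀) y₀)) :
    ∃ y : X → E, y x₀ = y₀ ∧ ContDiffAt 𝕜 r y x₀ ∧ ∀ᶠ x in 𝓝 x₀, G x (y x) = G x₀ y₀ := by
  have hpartial : HasFDerivAt (G x₀)
      ((fderiv 𝕜 (Function.uncurry G) (x₀, y₀)).comp (.inr 𝕜 X E)) y₀ :=
    (hG.differentiableAt hr).hasFDerivAt.comp y₀ (hasFDerivAt_prodMk_right x₀ y₀)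
  have hinv := isInvertible_of_bijective (hpartial.fderiv ▸ hreg)
  exact ⟨hG.implicitFunction hr hinv, hG.implicitFunction_apply_self hr hinv,
    hG.contDiffAt_implicitFunction hr hinv, hG.eventually_apply_implicitFunction hr hinv⟩

end InverseFunction

section StageEquations

variable {ι E F X : Type*} [NormedAddCommGroup E] [NormedSpace ℝ E]
  [NormedAddCommGroup F] [NormedSpace ℝ F] [NormedAddCommGroup X] [NormedSpace ℝ X]

lemma hasFDerivAt_comp_pi {f : E → F} {Y : X → ι → E} {Y' : X →L[ℝ] ι → E} {x : X}
    (hf : ∀ i, DifferentiableAt ℝ f (Y x i)) (hY : HasFDerivAt Y Y' x) :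
    HasFDerivAt (fun x => f ∘ Y x)
      ((ContinuousLinearMap.piMap fun i => fderiv ℝ f (Y x i)) ∘L Y') x :=
  hasFDerivAt_pi.2 fun i => (hf i).hasFDerivAt.comp x (hasFDerivAt_pi'.1 hY i)

/-- The part `S ↦ S - A (f ∘ S)` of the stage equations which does not contain the initial value:
`S` are stages of a Runge–Kutta step for `f` from `x` if and only if
`stageResidual A f S = fun _ => x`, where the linear map `A` is the coefficient matrix of the method
multiplied by the step size. -/
def stageResidual (A : (ι → E) →L[ℝ] (ι → E)) (f : E → E) (S : ι → E) : ι → E :=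
  S - A (f ∘ S)

variable {A : (ι → E) →L[ℝ] (ι → E)} {f : E → E} {S S' : ι → E} {M : ℝ}

lemma fderiv_stageResidual [Finite ι] (hf : ∀ i, DifferentiableAt ℝ f (S i)) :
    fderiv ℝ (stageResidual A f) S =
      1 - A ∘L ContinuousLinearMap.piMap fun i => fderiv ℝ f (S i) :=
  have := Fintype.ofFinite ι
  ((hasFDerivAt_id S).sub
    (A.hasFDerivAt.comp S (hasFDerivAt_comp_pi hf (hasFDerivAt_id S)))).fderiv

lemma fderiv_stageResidual_apply [Finite ι] (hf : ∀ i, DifferentiableAt ℝ f (S i)) (δ : ι → E) :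
    fderiv ℝ (stageResidual A f) S δ = δ - A fun i => fderiv ℝ f (S i) (δ i) := by
  rw [fderiv_stageResidual hf]
  rfl

lemma fderiv_of_stageResidual_eq_const [Finite ι] {Y : E → ι → E} {x : E}
    (hf : ∀ i, DifferentiableAt ℝ f (Y x i)) (hY : DifferentiableAt ℝ Y x)
    (heq : stageResidual A f ∘ Y =ᶠ[𝓝 x] fun x' _ => x') (u : E) :
    fderiv ℝ Y x u = (fun _ => u) + A fun i => fderiv ℝ f (Y x i) (fderiv ℝ Y x u i) := by
  have := Fintype.ofFinite ι
  have hleft : HasFDerivAt (stageResidual A f ∘ Y) _ x :=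
    hY.hasFDerivAt.sub (A.hasFDerivAt.comp x (hasFDerivAt_comp_pi hf hY.hasFDerivAt))
  have hright : HasFDerivAt (stageResidual A f ∘ Y)
      (ContinuousLinearMap.pi fun _ => ContinuousLinearMap.id ℝ E) x :=
    (hasFDerivAt_pi.2 fun _ => hasFDerivAt_id x).congr_of_eventuallyEq heq
  exact sub_eq_iff_eq_add.1 (DFunLike.congr_fun (hleft.unique hright) u)

variable [Fintype ι]

lemma contDiffAt_comp_pi {f : E → F} {Y : X → ι → E} {x : X} {r : WithTop ℕ∞}
    (hf : ∀ i, ContDiffAt ℝ r f (Y x i)) (hY : ContDiffAt ℝ r Y x) :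
    ContDiffAt ℝ r (fun x => f ∘ Y x) x :=
  contDiffAt_pi.2 fun i => (hf i).comp x (contDiffAt_pi.1 hY i)

lemma contDiffAt_stageResidual {r : WithTop ℕ∞} (hf : ∀ i, ContDiffAt ℝ r f (S i)) :
    ContDiffAt ℝ r (stageResidual A f) S :=
  contDiffAt_id.sub (A.contDiff.contDiffAt.comp S (contDiffAt_comp_pi hf contDiffAt_id))

lemma norm_apply_le_of_forall_norm_le (A : (ι → E) →L[ℝ] (ι → E)) (hM : 0 ≤ M)
    (hS : ∀ i, ‖S i‖ ≤ M) : ‖A S‖ ≤ ‖A‖ * M :=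
  A.le_opNorm_of_le ((pi_norm_le_iff_of_nonneg hM).2 hS)

lemma bijective_fderiv_stageResidual [CompleteSpace E] (hf : ∀ i, DifferentiableAt ℝ f (S i))
    (hM : 0 ≤ M) (hfM : ∀ i, ‖fderiv ℝ f (S i)‖ ≤ M) (hA : ‖A‖ * M < 1) :
    Function.Bijective (fderiv ℝ (stageResidual A f) S) := by
  rw [fderiv_stageResidual hf, ← ContinuousLinearMap.isUnit_iff_bijective]
  refine isUnit_one_sub_of_norm_lt_one (lt_of_le_of_lt ?_ hA)
  refine ContinuousLinearMap.opNorm_le_bound _ (by positivity) fun δ => ?_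
  rw [mul_assoc]
  exact norm_apply_le_of_forall_norm_le A (by positivity) fun i =>
    (fderiv ℝ f (S i)).le_of_opNorm_le_of_le (hfM i) (norm_le_pi_norm δ i)

lemma norm_apply_comp_sub_le {B : Set E} (hB : Convex ℝ B) (hM : 0 ≤ M)
    (hf : ∀ y ∈ B, DifferentiableAt ℝ f y) (hfM : ∀ y ∈ B, ‖fderiv ℝ f y‖ ≤ M)
    (hS : ∀ i, S i ∈ B) (hS' : ∀ i, S' i ∈ B) :
    ‖A (f ∘ S) - A (f ∘ S')‖ ≤ ‖A‖ * M * ‖S - S'‖ := by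
  rw [← map_sub, mul_assoc]
  refine norm_apply_le_of_forall_norm_le A (by positivity) fun i => ?_
  exact (hB.norm_image_sub_le_of_norm_fderiv_le hf hfM (hS' i) (hS i)).trans
    (mul_le_mul_of_nonneg_left (norm_le_pi_norm (S - S') i) hM)

lemma norm_sub_le_two_mul_norm_stageResidual_sub {B : Set E} (hB : Convex ℝ B) (hM : 0 ≤ M)
    (hf : ∀ y ∈ B, DifferentiableAt ℝ f y) (hfM : ∀ y ∈ B, ‖fderiv ℝ f y‖ ≤ M)
    (hA : ‖A‖ * M ≤ 1 / 2) (hS : ∀ i, S i ∈ B) (hS' : ∀ i, S' i ∈ B) :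
    ‖S - S'‖ ≤ 2 * ‖stageResidual A f S - stageResidual A f S'‖ := by
  have hdecomp : S - S' = stageResidual A f S - stageResidual A f S' +
      (A (f ∘ S) - A (f ∘ S')) := by
    simp only [stageResidual]
    abel
  have htriangle := norm_add_le (stageResidual A f S - stageResidual A f S')
    (A (f ∘ S) - A (f ∘ S'))
  rw [← hdecomp] at htriangle
  have hlip := norm_apply_comp_sub_le (A := A) hB hM hf hfM hS hS'
  have hhalf := mul_le_mul_of_nonneg_right hA (norm_nonneg (S - S'))
  linarith

lemma exists_stageResidual_eq_const [CompleteSpace E] {x : E} {ρ : ℝ} (hρ : 0 ≤ ρ) (hM : 0 ≤ M)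
    (hf : ∀ y ∈ Metric.closedBall x ρ, DifferentiableAt ℝ f y)
    (hfM : ∀ y ∈ Metric.closedBall x ρ, ‖f y‖ ≤ M ∧ ‖fderiv ℝ f y‖ ≤ M)
    (hAρ : ‖A‖ * M ≤ ρ) (hA : ‖A‖ * M ≤ 1 / 2) :
    ∃ S : ι → E, (∀ i, S i ∈ Metric.closedBall x ρ) ∧ stageResidual A f S = fun _ => x := by
  let Ψ : (ι → E) → ι → E := fun S => (fun _ => x) + A (f ∘ S)
  have hmaps : Set.MapsTo Ψ (Metric.closedBall (fun _ => x) ρ)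
      (Metric.closedBall (fun _ => x) ρ) := by
    intro S hS
    rw [mem_closedBall_iff_norm, add_sub_cancel_left]
    exact (norm_apply_le_of_forall_norm_le A hM fun i =>
      (hfM _ ((dist_pi_le_iff hρ).1 hS i)).1).trans hAρ
  have hcontr : ContractingWith (1 / 2) (hmaps.restrict Ψ _ _) := by
    refine ⟨by norm_num, LipschitzWith.of_dist_le_mul fun S S' => ?_⟩
    have hlip := norm_apply_comp_sub_le (A := A) (convex_closedBall x ρ) hM hf
      (fun y hy => (hfM y hy).2) ((dist_pi_le_iff hρ).1 S.2) ((dist_pi_le_iff hρ).1 S'.2)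
    rw [Subtype.dist_eq, Subtype.dist_eq, dist_eq_norm, dist_eq_norm, Set.MapsTo.val_restrict_apply,
      Set.MapsTo.val_restrict_apply, add_sub_add_left_eq_sub]
    exact hlip.trans (mul_le_mul_of_nonneg_right (by simpa using hA) (norm_nonneg _))
  obtain ⟨S, hS, hfix, -⟩ := hcontr.exists_fixedPoint' Metric.isClosed_closedBall.isComplete hmaps
    (Metric.mem_closedBall_self hρ) (edist_ne_top _ _)
  exact ⟨S, (dist_pi_le_iff hρ).1 hS, sub_eq_iff_eq_add.2 hfix.symm⟩

lemma exists_bounds_on_closedBall [ProperSpace E] {Ω D : Set E} (hΩ : IsOpen Ω)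
    (hf : ContDiffOn ℝ 1 f Ω) (hD : IsCompact D) (hDΩ : D ⊆ Ω) :
    ∃ δ > 0, ∃ M ≥ 0, ∀ x ∈ D, Metric.closedBall x δ ⊆ Ω ∧
      ∀ y ∈ Metric.closedBall x δ, ‖f y‖ ≤ M ∧ ‖fderiv ℝ f y‖ ≤ M := by
  obtain ⟨δ, hδ, hsub⟩ := hD.exists_cthickening_subset_open hΩ hDΩ
  have hcompact : IsCompact (Metric.cthickening δ D) := hD.cthickening
  obtain ⟨M, hM⟩ := hcompact.exists_bound_of_continuousOn (hf.continuousOn.mono hsub)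
  obtain ⟨L, hL⟩ := hcompact.exists_bound_of_continuousOn
    ((hf.continuousOn_fderiv_of_isOpen hΩ le_rfl).mono hsub)
  have hball : ∀ x ∈ D, Metric.closedBall x δ ⊆ Metric.cthickening δ D := fun x hx =>
    Metric.closedBall_subset_cthickening hx δ
  exact ⟨δ, hδ, max 0 (max M L), le_max_left _ _, fun x hx => ⟨(hball x hx).trans hsub, fun y hy =>
    ⟨(hM y (hball x hx hy)).trans (le_max_of_le_right (le_max_left _ _)),
      (hL y (hball x hx hy)).trans (le_max_of_le_right (le_max_right _ _))⟩⟩⟩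

lemma continuousOn_of_stageResidual_eq_const {D : Set E} {δ ρ : ℝ} (hρδ : ρ < δ) (hM : 0 ≤ M)
    (hf : ∀ x ∈ D, ∀ y ∈ Metric.closedBall x δ, DifferentiableAt ℝ f y)
    (hfM : ∀ x ∈ D, ∀ y ∈ Metric.closedBall x δ, ‖fderiv ℝ f y‖ ≤ M) (hA : ‖A‖ * M ≤ 1 / 2)
    {Y : E → ι → E} (hYρ : ∀ x ∈ D, ∀ i, Y x i ∈ Metric.closedBall x ρ)
    (hY : ∀ x ∈ D, stageResidual A f (Y x) = fun _ => x) : ContinuousOn Y D := by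
  intro x hx
  refine tendsto_iff_norm_sub_tendsto_zero.2 (squeeze_zero' (Eventually.of_forall fun _ =>
    norm_nonneg _) ?_ (g := fun x' => 2 * ‖x' - x‖) ?_)
  · filter_upwards [self_mem_nhdsWithin, mem_nhdsWithin_of_mem_nhds
      (Metric.closedBall_mem_nhds x (sub_pos.2 hρδ))] with x' hx' hdist
    have hmem : ∀ i, Y x' i ∈ Metric.closedBall x δ := fun i => by
      have hi := hYρ x' hx' i
      rw [Metric.mem_closedBall] at hi hdist ⊢
      linarith [dist_triangle (Y x' i) x' x]
    refine (norm_sub_le_two_mul_norm_stageResidual_sub (convex_closedBall x δ) hM (hf x hx)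
      (hfM x hx) hA hmem fun i => Metric.closedBall_subset_closedBall hρδ.le (hYρ x hx i)).trans
      (mul_le_mul_of_nonneg_left ?_ zero_le_two)
    rw [hY x' hx', hY x hx]
    exact pi_norm_const_le (x' - x)
  · have hcont : Continuous fun x' => 2 * ‖x' - x‖ := by fun_prop
    simpa using hcont.continuousWithinAt (s := D) (x := x) |>.tendsto

theorem exists_stages_of_norm_lt [ProperSpace E] {Ω D : Set E} (hΩ : IsOpen Ω)
    (hf : ContDiffOn ℝ 1 f Ω) (hD : IsCompact D) (hDΩ : D ⊆ Ω) {ε : ℝ} (hε : 0 < ε) :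
    ∃ c > 0, ∀ A : (ι → E) →L[ℝ] (ι → E), ‖A‖ < c → ∃ Y : E → ι → E, ContinuousOn Y D ∧
      ∀ x ∈ D, (∀ i, Y x i ∈ Ω ∧ dist (Y x i) x < ε) ∧ stageResidual A f (Y x) = (fun _ => x) ∧
        Function.Bijective (fderiv ℝ (stageResidual A f) (Y x)) := by
  obtain ⟨δ, hδ, M, hM, hbound⟩ := exists_bounds_on_closedBall hΩ hf hD hDΩ
  obtain ⟨ρ, hρ, hρmin⟩ := exists_between (lt_min hδ hε)
  obtain ⟨hρδ, hρε⟩ := lt_min_iff.1 hρmin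
  have hdiff : ∀ x ∈ D, ∀ y ∈ Metric.closedBall x δ, DifferentiableAt ℝ f y := fun x hx y hy =>
    (hf.contDiffAt (hΩ.mem_nhds ((hbound x hx).1 hy))).differentiableAt one_ne_zero
  refine ⟨min ρ (1 / 2) / (M + 1), by positivity, fun A hA => ?_⟩
  have hAM : ‖A‖ * M ≤ min ρ (1 / 2) := by
    rw [lt_div_iff₀ (by positivity)] at hA
    nlinarith [norm_nonneg A]
  obtain ⟨hAρ, hAhalf⟩ := le_min_iff.1 hAM
  have hball : ∀ x : E, Metric.closedBall x ρ ⊆ Metric.closedBall x δ := fun x =>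
    Metric.closedBall_subset_closedBall hρδ.le
  have hexists : ∀ x ∈ D, ∃ S : ι → E, (∀ i, S i ∈ Metric.closedBall x ρ) ∧
      stageResidual A f S = fun _ => x := fun x hx =>
    exists_stageResidual_eq_const hρ.le hM (fun y hy => hdiff x hx y (hball x hy))
      (fun y hy => (hbound x hx).2 y (hball x hy)) hAρ hAhalf
  choose! Y hYρ hY using hexists
  have hYδ : ∀ x ∈ D, ∀ i, Y x i ∈ Metric.closedBall x δ := fun x hx i => hball x (hYρ x hx i)
  refine ⟨Y, continuousOn_of_stageResidual_eq_const hρδ hM hdiff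
    (fun x hx y hy => ((hbound x hx).2 y hy).2) hAhalf hYρ hY, fun x hx => ⟨fun i =>
      ⟨(hbound x hx).1 (hYδ x hx i), (hYρ x hx i).trans_lt hρε⟩, hY x hx, ?_⟩⟩
  exact bijective_fderiv_stageResidual (fun i => hdiff x hx _ (hYδ x hx i)) hM
    (fun i => ((hbound x hx).2 _ (hYδ x hx i)).2) (hAhalf.trans_lt (by norm_num))

variable {Y : E → ι → E} {x : E}

lemma contDiffAt_of_stageResidual_eq_const [CompleteSpace E] {r : WithTop ℕ∞} (hr : r ≠ 0)
    (hf : ∀ i, ContDiffAt ℝ r f (Y x i))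
    (hreg : Function.Bijective (fderiv ℝ (stageResidual A f) (Y x))) (hY : ContinuousAt Y x)
    (heq : stageResidual A f ∘ Y =ᶠ[𝓝 x] fun x' _ => x') : ContDiffAt ℝ r Y x :=
  contDiffAt_of_comp_contDiffAt hr (contDiffAt_stageResidual hf) hreg hY
    ((contDiffAt_pi.2 fun _ => contDiffAt_id).congr_of_eventuallyEq heq)

variable {g : X → E → E} {S₀ : ι → E} {x₀ : X} {r : WithTop ℕ∞}

lemma contDiffAt_uncurry_comp_pi {Y : X → ι → E}
    (hg : ∀ i, ContDiffAt ℝ r (Function.uncurry g) (x₀, Y x₀ i)) (hY : ContDiffAt ℝ r Y x₀) :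
    ContDiffAt ℝ r (fun x => g x ∘ Y x) x₀ :=
  contDiffAt_pi.2 fun i =>
    (hg i).comp (f := fun x => (x, Y x i)) x₀ (contDiffAt_id.prodMk (contDiffAt_pi.1 hY i))

lemma contDiffAt_uncurry_stageResidual
    (hg : ∀ i, ContDiffAt ℝ r (Function.uncurry g) (x₀, S₀ i)) :
    ContDiffAt ℝ r (fun a : X × (ι → E) => stageResidual A (g a.1) a.2) (x₀, S₀) :=
  contDiffAt_snd.sub (A.contDiff.contDiffAt.comp (x₀, S₀) (contDiffAt_pi.2 fun i =>
    (hg i).comp (f := fun a : X × (ι → E) => (a.1, a.2 i)) (x₀, S₀)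
      (contDiffAt_fst.prodMk (contDiffAt_pi.1 contDiffAt_snd i))))

lemma exists_contDiffAt_stages [CompleteSpace E] [CompleteSpace X] (hr : r ≠ 0) {u : X → ι → E}
    (hg : ∀ i, ContDiffAt ℝ r (Function.uncurry g) (x₀, S₀ i)) (hu : ContDiffAt ℝ r u x₀)
    (heq : stageResidual A (g x₀) S₀ = u x₀)
    (hreg : Function.Bijective (fderiv ℝ (stageResidual A (g x₀)) S₀)) :
    ∃ S : X → ι → E, S x₀ = S₀ ∧ ContDiffAt ℝ r S x₀ ∧
      ∀ᶠ x in 𝓝 x₀, stageResidual A (g x) (S x) = u x := by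
  obtain ⟨S, hS₀, hS, hsol⟩ := exists_contDiffAt_implicit
    (G := fun x S => stageResidual A (g x) S - u x) hr
    ((contDiffAt_uncurry_stageResidual hg).sub (hu.comp (x₀, S₀) contDiffAt_fst))
    (by rwa [fderiv_sub_const])
  refine ⟨S, hS₀, hS, hsol.mono fun x hx => ?_⟩
  rwa [heq, sub_self, sub_eq_zero] at hx

end StageEquations

section LiftedStageEquations

variable {ι E : Type*} [NormedAddCommGroup E] [NormedSpace ℝ E]
  {A : (ι → E) →L[ℝ] (ι → E)} {f F : E → E}

lemma stageResidual_map {G : Type*} [FunLike G E E] [AddMonoidHomClass G E E] (L : G)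
    (hA : ∀ v, A (L ∘ v) = L ∘ A v) {S : ι → E} (hf : ∀ i, L (F (S i)) = f (L (S i))) :
    stageResidual A f (L ∘ S) = L ∘ stageResidual A F S := by
  have hcomp : f ∘ L ∘ S = L ∘ F ∘ S := funext fun i => (hf i).symm
  funext i
  simp only [stageResidual, hcomp, hA, Pi.sub_apply, Function.comp_apply, map_sub]

/-- `F` lifts `f` along the linear map `L` over `Ω`: the map `L` intertwines the vector fields, and
on each fibre of `L` the lift is affine with linear part the derivative of `f`. Regular solutions of
the stage equations can then be lifted, although `L` need not be injective. -/
structure IsLinearLift (L : E →L[ℝ] E) (F f : E → E) (Ω : Set E) : Prop where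
  isOpen : IsOpen Ω
  differentiableAt : ∀ x ∈ Ω, DifferentiableAt ℝ f x
  differentiableAt_lift : ∀ c, L c ∈ Ω → DifferentiableAt ℝ F c
  map_lift : ∀ c, L c ∈ Ω → L (F c) = f (L c)
  lift_add : ∀ c δ, L c ∈ Ω → L δ = 0 → F (c + δ) = F c + fderiv ℝ f (L c) δ

lemma fderiv_apply_of_quadratic {G : Type*} [NormedAddCommGroup G] [NormedSpace ℝ G] {f : E → G}
    {x ξ : E} {a b : G} (hf : DifferentiableAt ℝ f x)
    (h : ∀ t : ℝ, f (x + t • ξ) = f x + t • a + t ^ 2 • b) : fderiv ℝ f x ξ = a := by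
  have hline : HasDerivAt (fun t : ℝ => f (x + t • ξ)) (fderiv ℝ f x ξ) 0 :=
    hf.hasFDerivAt.hasLineDerivAt ξ
  have hpoly : HasDerivAt (fun t : ℝ => f x + t • a + t ^ 2 • b) a 0 :=
    (((hasDerivAt_const (0 : ℝ) (f x)).add ((hasDerivAt_id (0 : ℝ)).smul_const a)).add
      ((hasDerivAt_pow 2 (0 : ℝ)).smul_const b)).congr_deriv (by simp)
  simp only [h] at hline
  exact hline.unique hpoly

namespace IsLinearLift

variable {L : E →L[ℝ] E} {Ω : Set E} {c δ : ι → E}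

lemma map_fderiv (hF : IsLinearLift L F f Ω) {c : E} (hc : L c ∈ Ω) (δ : E) :
    L (fderiv ℝ F c δ) = fderiv ℝ f (L c) (L δ) := by
  have hev : L ∘ F =ᶠ[𝓝 c] f ∘ L := by
    filter_upwards [L.continuous.continuousAt (hF.isOpen.mem_nhds hc)] with c' hc'
      using hF.map_lift c' hc'
  have hLF := L.hasFDerivAt.comp c (hF.differentiableAt_lift c hc).hasFDerivAt
  have hfL := (hF.differentiableAt _ hc).hasFDerivAt.comp c L.hasFDerivAt
  exact DFunLike.congr_fun (hLF.unique (hfL.congr_of_eventuallyEq hev)) δ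

lemma fderiv_apply (hF : IsLinearLift L F f Ω) {c δ : E} (hc : L c ∈ Ω) (hδ : L δ = 0) :
    fderiv ℝ F c δ = fderiv ℝ f (L c) δ :=
  fderiv_apply_of_quadratic (b := 0) (hF.differentiableAt_lift c hc) fun t => by
    rw [hF.lift_add c _ hc (by rw [map_smul, hδ, smul_zero]), map_smul, smul_zero, add_zero]

variable [Finite ι]

lemma stageResidual_add (hF : IsLinearLift L F f Ω) (hc : ∀ i, L (c i) ∈ Ω)
    (hδ : L ∘ δ = 0) : stageResidual A F (c + δ) =
      stageResidual A F c + fderiv ℝ (stageResidual A f) (L ∘ c) δ := by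
  have hcomp : F ∘ (c + δ) = F ∘ c + fun i => fderiv ℝ f (L (c i)) (δ i) :=
    funext fun i => hF.lift_add (c i) (δ i) (hc i) (congrFun hδ i)
  rw [fderiv_stageResidual_apply (S := L ∘ c) (fun i => hF.differentiableAt _ (hc i)),
    stageResidual, hcomp, map_add, stageResidual]
  simp only [Function.comp_apply]
  abel

lemma fderiv_stageResidual_apply_of_comp_eq_zero (hF : IsLinearLift L F f Ω)
    (hc : ∀ i, L (c i) ∈ Ω) (hδ : L ∘ δ = 0) :
    fderiv ℝ (stageResidual A F) c δ = fderiv ℝ (stageResidual A f) (L ∘ c) δ := by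
  rw [fderiv_stageResidual_apply (fun i => hF.differentiableAt_lift _ (hc i)),
    fderiv_stageResidual_apply (S := L ∘ c) (fun i => hF.differentiableAt _ (hc i))]
  congr 2
  exact funext fun i => hF.fderiv_apply (hc i) (congrFun hδ i)

lemma comp_fderiv_stageResidual (hF : IsLinearLift L F f Ω) (hA : ∀ v, A (L ∘ v) = L ∘ A v)
    (hc : ∀ i, L (c i) ∈ Ω) (δ : ι → E) :
    L ∘ fderiv ℝ (stageResidual A F) c δ = fderiv ℝ (stageResidual A f) (L ∘ c) (L ∘ δ) := by
  have hcomp : (fun i => fderiv ℝ f ((L ∘ c) i) ((L ∘ δ) i)) =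
      L ∘ fun i => fderiv ℝ F (c i) (δ i) :=
    funext fun i => (hF.map_fderiv (hc i) (δ i)).symm
  rw [fderiv_stageResidual_apply (fun i => hF.differentiableAt_lift _ (hc i)),
    fderiv_stageResidual_apply (S := L ∘ c) (fun i => hF.differentiableAt _ (hc i)), hcomp, hA]
  exact funext fun i => map_sub L _ _

variable [FiniteDimensional ℝ E]

lemma bijective_fderiv_stageResidual (hF : IsLinearLift L F f Ω)
    (hA : ∀ v, A (L ∘ v) = L ∘ A v) (hc : ∀ i, L (c i) ∈ Ω)
    (hreg : Function.Bijective (fderiv ℝ (stageResidual A f) (L ∘ c))) :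
    Function.Bijective (fderiv ℝ (stageResidual A F) c) := by
  have hinj : Function.Injective (fderiv ℝ (stageResidual A F) c).toLinearMap := by
    refine (injective_iff_map_eq_zero _).2 fun δ (hδ : fderiv ℝ (stageResidual A F) c δ = 0) => ?_
    have hLδ : L ∘ δ = 0 := by
      refine (injective_iff_map_eq_zero _).1 hreg.1 _ ?_
      rw [← hF.comp_fderiv_stageResidual hA hc, hδ]
      exact funext fun _ => map_zero L
    rw [hF.fderiv_stageResidual_apply_of_comp_eq_zero hc hLδ] at hδ
    exact (injective_iff_map_eq_zero _).1 hreg.1 _ hδ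
  exact ⟨hinj, LinearMap.surjective_of_injective hinj⟩

lemma exists_fderiv_stageResidual_eq (hF : IsLinearLift L F f Ω)
    (hA : ∀ v, A (L ∘ v) = L ∘ A v) (hc : ∀ i, L (c i) ∈ Ω)
    (hreg : Function.Bijective (fderiv ℝ (stageResidual A f) (L ∘ c))) {η : ι → E}
    (hη : L ∘ η = 0) :
    ∃ δ : ι → E, L ∘ δ = 0 ∧ fderiv ℝ (stageResidual A f) (L ∘ c) δ = η := by
  let ker : Submodule ℝ (ι → E) := LinearMap.ker (L.toLinearMap.compLeft ι)
  have hmaps (δ : ι → E) (hδ : δ ∈ ker) :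
      (fderiv ℝ (stageResidual A f) (L ∘ c)).toLinearMap δ ∈ ker := by
    have hLδ : L ∘ δ = 0 := hδ
    change L ∘ fderiv ℝ (stageResidual A f) (L ∘ c) δ = 0
    rw [← hF.fderiv_stageResidual_apply_of_comp_eq_zero hc hLδ,
      hF.comp_fderiv_stageResidual hA hc, hLδ, map_zero]
  have hinj : Function.Injective (LinearMap.restrict _ hmaps) := fun δ δ' h =>
    Subtype.ext (hreg.1 (congrArg Subtype.val h))
  obtain ⟨δ, hδ⟩ := LinearMap.surjective_of_injective hinj ⟨η, hη⟩
  exact ⟨δ, δ.2, congrArg Subtype.val hδ⟩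

theorem exists_stages (hF : IsLinearLift L F f Ω) (hA : ∀ v, A (L ∘ v) = L ∘ A v)
    (hc : ∀ i, L (c i) ∈ Ω)
    (hreg : Function.Bijective (fderiv ℝ (stageResidual A f) (L ∘ c))) {u : ι → E}
    (hu : stageResidual A f (L ∘ c) = L ∘ u) :
    ∃ c' : ι → E, L ∘ c' = L ∘ c ∧ stageResidual A F c' = u ∧
      Function.Bijective (fderiv ℝ (stageResidual A F) c') := by
  have hη : L ∘ (u - stageResidual A F c) = 0 := by
    rw [stageResidual_map L hA fun i => hF.map_lift _ (hc i)] at hu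
    exact funext fun i => (map_sub L _ _).trans (sub_eq_zero.2 (congrFun hu i).symm)
  obtain ⟨δ, hδ, heq⟩ := hF.exists_fderiv_stageResidual_eq hA hc hreg hη
  have hcδ : L ∘ (c + δ) = L ∘ c :=
    funext fun i => (map_add L _ _).trans (add_eq_left.2 (congrFun hδ i))
  refine ⟨c + δ, hcδ, ?_, ?_⟩
  · rw [hF.stageResidual_add hc hδ, heq, add_sub_cancel]
  · exact hF.bijective_fderiv_stageResidual hA (fun i => (congrFun hcδ i).symm.subst (hc i))
      (by rwa [hcδ])

end IsLinearLift

end LiftedStageEquations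

/-- The linear map `scaleN α β γ`. -/
def scaleL (α β γ : ℝ) : SpaceN n m →L[ℝ] SpaceN n m :=
  (α • (1 : _ →L[ℝ] _)).prodMap ((α • (1 : _ →L[ℝ] _)).prodMap
    ((β • (1 : _ →L[ℝ] _)).prodMap (γ • (1 : _ →L[ℝ] _))))

namespace PRKMethod

/-- The coefficients `a` of a method as a linear map: it sends the values of the vector field at the
stages to the increments of the stages for the step `1`. -/
def stageLin (T : PRKMethod s) : (Fin s → SpaceN n m) →L[ℝ] (Fin s → SpaceN n m) :=
  .pi fun i => ∑ j, scaleL (T.tz.a i j) (T.tp.a i j) (T.tq.a i j) ∘L .proj j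

/-- The coefficients `b` of a method as a linear map: it sends the values of the vector field at the
stages to the increment of the update for the step `1`. -/
def updateLin (T : PRKMethod s) : (Fin s → SpaceN n m) →L[ℝ] SpaceN n m :=
  ∑ i, scaleL (T.tz.b i) (T.tp.b i) (T.tq.b i) ∘L .proj i

variable (T : PRKMethod s) (h : ℝ) (f : SpaceN n m → SpaceN n m) (x : SpaceN n m)
  (S : Fin s → SpaceN n m)

lemma stageLin_apply (i : Fin s) :
    T.stageLin S i = ∑ j, scaleN (T.tz.a i j) (T.tp.a i j) (T.tq.a i j) (S j) := by
  simp only [stageLin, ContinuousLinearMap.pi_apply, sum_apply]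
  rfl

lemma updateLin_apply :
    T.updateLin S = ∑ i, scaleN (T.tz.b i) (T.tp.b i) (T.tq.b i) (S i) := by
  simp only [updateLin, sum_apply]
  rfl

lemma stageMap_eq : T.stageMap h f x S = (fun _ => x) + (h • T.stageLin) (f ∘ S) := by
  ext1 i
  exact congrArg (x + h • ·) (T.stageLin_apply (f ∘ S) i).symm

lemma update_eq : T.update h f x S = x + h • T.updateLin (f ∘ S) :=
  congrArg (x + h • ·) (T.updateLin_apply (f ∘ S)).symm

lemma eq_stageMap_iff :
    S = T.stageMap h f x S ↔ stageResidual (h • T.stageLin) f S = fun _ => x := by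
  rw [T.stageMap_eq, stageResidual, sub_eq_iff_eq_add]

lemma fderiv_sub_stageMap :
    fderiv ℝ (fun S => S - T.stageMap h f x S) S =
      fderiv ℝ (stageResidual (h • T.stageLin) f) S := by
  simp only [T.stageMap_eq, sub_add_eq_sub_sub_swap]
  exact fderiv_sub_const (f := stageResidual (h • T.stageLin) f) _

end PRKMethod

namespace PRKMethod.IsIntegrator

variable {T : PRKMethod s} {h : ℝ} {f : SpaceN n m → SpaceN n m} {Ω V : Set (SpaceN n m)}
  {Y : SpaceN n m → Fin s → SpaceN n m} {x : SpaceN n m}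

lemma mono (hI : T.IsIntegrator h f Ω V Y) {V' : Set (SpaceN n m)} (hV : V' ⊆ V) :
    T.IsIntegrator h f Ω V' Y :=
  ⟨hI.continuousOn.mono hV, fun x hx => hI.mem_domain x (hV hx),
    fun x hx => hI.stage_eq x (hV hx), fun x hx => hI.regular x (hV hx)⟩

lemma stageResidual_eq (hI : T.IsIntegrator h f Ω V Y) (hx : x ∈ V) :
    stageResidual (h • T.stageLin) f (Y x) = fun _ => x :=
  (T.eq_stageMap_iff h f x (Y x)).1 (hI.stage_eq x hx)

lemma bijective_fderiv_stageResidual (hI : T.IsIntegrator h f Ω V Y) (hx : x ∈ V) :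
    Function.Bijective (fderiv ℝ (stageResidual (h • T.stageLin) f) (Y x)) := by
  rw [← T.fderiv_sub_stageMap h f x]
  exact hI.regular x hx

lemma stageResidual_eventuallyEq (hI : T.IsIntegrator h f Ω V Y) (hV : IsOpen V) (hx : x ∈ V) :
    stageResidual (h • T.stageLin) f ∘ Y =ᶠ[𝓝 x] fun x' _ => x' := by
  filter_upwards [hV.mem_nhds hx] with x' hx' using hI.stageResidual_eq hx'

lemma contDiffAt_vectorField (hI : T.IsIntegrator h f Ω V Y) (hΩ : IsOpen Ω) {r : WithTop ℕ∞}
    (hf : ContDiffOn ℝ r f Ω) (hx : x ∈ V) (i : Fin s) : ContDiffAt ℝ r f (Y x i) :=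
  hf.contDiffAt (hΩ.mem_nhds (hI.mem_domain x hx i))

lemma contDiffAt_stages (hI : T.IsIntegrator h f Ω V Y) (hΩ : IsOpen Ω) (hV : IsOpen V)
    {r : WithTop ℕ∞} (hr : r ≠ 0) (hf : ContDiffOn ℝ r f Ω) (hx : x ∈ V) : ContDiffAt ℝ r Y x :=
  contDiffAt_of_stageResidual_eq_const hr (hI.contDiffAt_vectorField hΩ hf hx)
    (hI.bijective_fderiv_stageResidual hx) (hI.continuousOn.continuousAt (hV.mem_nhds hx))
    (hI.stageResidual_eventuallyEq hV hx)

lemma contDiffAt_update (hI : T.IsIntegrator h f Ω V Y) (hΩ : IsOpen Ω) (hV : IsOpen V)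
    {r : WithTop ℕ∞} (hr : r ≠ 0) (hf : ContDiffOn ℝ r f Ω) (hx : x ∈ V) :
    ContDiffAt ℝ r (fun x => T.update h f x (Y x)) x := by
  simp only [T.update_eq]
  exact contDiffAt_id.add ((T.updateLin.contDiff.contDiffAt.comp x (contDiffAt_comp_pi
    (hI.contDiffAt_vectorField hΩ hf hx) (hI.contDiffAt_stages hΩ hV hr hf hx))).const_smul h)

lemma exists_fderiv_update_eq (hI : T.IsIntegrator h f Ω V Y) (hΩ : IsOpen Ω) (hV : IsOpen V)
    (hf : ContDiffOn ℝ 1 f Ω) (hx : x ∈ V) (u : SpaceN n m) :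
    ∃ ξ : Fin s → SpaceN n m,
      ξ = (fun _ => u) + (h • T.stageLin) (fun i => fderiv ℝ f (Y x i) (ξ i)) ∧
      fderiv ℝ (fun x => T.update h f x (Y x)) x u =
        u + h • T.updateLin (fun i => fderiv ℝ f (Y x i) (ξ i)) := by
  have hf' i := (hI.contDiffAt_vectorField hΩ hf hx i).differentiableAt one_ne_zero
  have hY := (hI.contDiffAt_stages hΩ hV one_ne_zero hf hx).differentiableAt one_ne_zero
  refine ⟨fderiv ℝ Y x u,
    fderiv_of_stageResidual_eq_const hf' hY (hI.stageResidual_eventuallyEq hV hx) u, ?_⟩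
  simp only [T.update_eq]
  have hupdate : HasFDerivAt (fun x => x + h • T.updateLin (f ∘ Y x)) _ x :=
    (hasFDerivAt_id x).add ((T.updateLin.hasFDerivAt.comp x
      (hasFDerivAt_comp_pi hf' hY.hasFDerivAt)).const_smul h)
  rw [hupdate.fderiv]
  rfl

end PRKMethod.IsIntegrator

theorem PRKMethod.exists_isIntegrator (T : PRKMethod s) {f : SpaceN n m → SpaceN n m}
    {Ω D : Set (SpaceN n m)} (hΩ : IsOpen Ω) (hf : ContDiffOn ℝ 1 f Ω) (hD : IsCompact D)
    (hDΩ : D ⊆ Ω) {ε : ℝ} (hε : 0 < ε) :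
    ∃ h₀ > 0, ∀ h : ℝ, |h| < h₀ → ∃ Y, T.IsIntegrator h f Ω D Y ∧
      ∀ x ∈ D, ∀ i, dist (Y x i) x < ε := by
  obtain ⟨c, hc, hstages⟩ := exists_stages_of_norm_lt (ι := Fin s) hΩ hf hD hDΩ hε
  refine ⟨c / (‖T.stageLin (n := n) (m := m)‖ + 1), by positivity, fun h hh => ?_⟩
  have hnorm : ‖h • T.stageLin (n := n) (m := m)‖ < c := by
    rw [lt_div_iff₀ (by positivity)] at hh
    rw [norm_smul, Real.norm_eq_abs]
    linarith [abs_nonneg h]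
  obtain ⟨Y, hYcont, hY⟩ := hstages _ hnorm
  refine ⟨Y, ⟨hYcont, fun x hx i => ((hY x hx).1 i).1, fun x hx => ?_, fun x hx => ?_⟩,
    fun x hx i => ((hY x hx).1 i).2⟩
  · exact (T.eq_stageMap_iff h f x (Y x)).2 (hY x hx).2.1
  · rw [T.fderiv_sub_stageMap]
    exact (hY x hx).2.2

/-- The linear isomorphism from covectors to vectors of `N` inverse to `u ↦ omegaN u ·`. -/
def sharpN : (SpaceN n m →L[ℝ] ℝ) →L[ℝ] SpaceN n m :=
  let ev (v : SpaceN n m) : (SpaceN n m →L[ℝ] ℝ) →L[ℝ] ℝ := .apply ℝ ℝ v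
  .prod (.pi fun j => Complex.equivRealProdCLM.symm ∘L
      .prod (-ev (Pi.single j Complex.I, 0, 0, 0)) (ev (Pi.single j 1, 0, 0, 0)))
    (.prod (.pi fun j => Complex.equivRealProdCLM.symm ∘L
        .prod (-ev (0, Pi.single j Complex.I, 0, 0)) (ev (0, Pi.single j 1, 0, 0)))
      (.prod (.pi fun i => -ev (0, 0, 0, Pi.single i 1))
        (.pi fun i => ev (0, 0, Pi.single i 1, 0))))

lemma hamVectorField_eq_sharpN (K : SpaceN n m → ℝ) (x : SpaceN n m) :
    hamVectorField K x = sharpN (fderiv ℝ K x) := rfl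

lemma covectorN_apply (α : SpaceN n m →L[ℝ] ℝ) (v : SpaceN n m) :
    α v = (∑ j, ((v.1 j).re * α (Pi.single j 1, 0, 0, 0)
          + (v.1 j).im * α (Pi.single j Complex.I, 0, 0, 0)))
      + (∑ j, ((v.2.1 j).re * α (0, Pi.single j 1, 0, 0)
          + (v.2.1 j).im * α (0, Pi.single j Complex.I, 0, 0)))
      + ∑ i, (v.2.2.2 i * α (0, 0, 0, Pi.single i 1) + v.2.2.1 i * α (0, 0, Pi.single i 1, 0)) := by
  have hv : v = (∑ j, ((v.1 j).re • ((Pi.single j 1, 0, 0, 0) : SpaceN n m)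
          + (v.1 j).im • ((Pi.single j Complex.I, 0, 0, 0) : SpaceN n m)))
      + (∑ j, ((v.2.1 j).re • ((0, Pi.single j 1, 0, 0) : SpaceN n m)
          + (v.2.1 j).im • ((0, Pi.single j Complex.I, 0, 0) : SpaceN n m)))
      + ∑ i, (v.2.2.2 i • ((0, 0, 0, Pi.single i 1) : SpaceN n m)
          + v.2.2.1 i • ((0, 0, Pi.single i 1, 0) : SpaceN n m)) := by
    ext k <;> simp [Prod.fst_sum, Prod.snd_sum, Finset.sum_apply, Pi.single_apply,
      Finset.sum_add_distrib, apply_ite]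
  conv_lhs => rw [hv]
  simp only [map_add, map_sum, map_smul, smul_eq_mul]

lemma omegaN_sharpN (α : SpaceN n m →L[ℝ] ℝ) (v : SpaceN n m) : omegaN (sharpN α) v = α v := by
  rw [covectorN_apply α v, omegaN]
  congr 1
  · congr 1 <;> refine Finset.sum_congr rfl fun j _ => ?_ <;> simp [sharpN] <;> ring
  · refine Finset.sum_congr rfl fun i _ => ?_
    simp [sharpN]
    ring

lemma omegaN_swap (u v : SpaceN n m) : omegaN u v = -omegaN v u := by
  simp only [omegaN, neg_add, ← Finset.sum_neg_distrib, neg_sub]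
  simp only [mul_comm]

lemma eq_of_forall_omegaN_eq {u u' : SpaceN n m} (h : ∀ v, omegaN u v = omegaN u' v) : u = u' := by
  refine Prod.ext (funext fun j => ?_)
    (Prod.ext (funext fun j => ?_) (Prod.ext (funext fun i => ?_) (funext fun i => ?_)))
  · refine Complex.ext ?_ ?_
    · simpa [omegaN, Pi.single_apply, apply_ite] using h (Pi.single j Complex.I, 0, 0, 0)
    · simpa [omegaN, Pi.single_apply, apply_ite] using h (Pi.single j 1, 0, 0, 0)
  · refine Complex.ext ?_ ?_
    · simpa [omegaN, Pi.single_apply, apply_ite] using h (0, Pi.single j Complex.I, 0, 0)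
    · simpa [omegaN, Pi.single_apply, apply_ite] using h (0, Pi.single j 1, 0, 0)
  · simpa [omegaN, Pi.single_apply] using h (0, 0, 0, Pi.single i 1)
  · simpa [omegaN, Pi.single_apply] using h (0, 0, Pi.single i 1, 0)

lemma contDiffOn_hamVectorField {K : SpaceN n m → ℝ} {Ω : Set (SpaceN n m)} {r : WithTop ℕ∞}
    (hΩ : IsOpen Ω) (hK : ContDiffOn ℝ (r + 1) K Ω) : ContDiffOn ℝ r (hamVectorField K) Ω :=
  (sharpN.contDiff (n := r)).comp_contDiffOn (hK.fderiv_of_isOpen hΩ le_rfl)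

lemma omegaN_fderiv_hamVectorField {K : SpaceN n m → ℝ} {x : SpaceN n m}
    (hK : ContDiffAt ℝ 2 K x) (ξ η : SpaceN n m) :
    omegaN (fderiv ℝ (hamVectorField K) x ξ) η +
      omegaN ξ (fderiv ℝ (hamVectorField K) x η) = 0 := by
  have hd : DifferentiableAt ℝ (fderiv ℝ K) x :=
    (hK.fderiv_right (m := 1) (by norm_num)).differentiableAt one_ne_zero
  have hX : HasFDerivAt (hamVectorField K) (sharpN ∘L fderiv ℝ (fderiv ℝ K) x) x :=
    sharpN.hasFDerivAt.comp x hd.hasFDerivAt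
  have hsymm : IsSymmSndFDerivAt ℝ K x := hK.isSymmSndFDerivAt (by simp)
  rw [hX.fderiv, omegaN_swap ξ]
  simp only [ContinuousLinearMap.comp_apply, omegaN_sharpN]
  rw [hsymm.eq ξ η, add_neg_cancel]

lemma IsSymplecticPair.symm {t t' : RKTableau s} (h : IsSymplecticPair t t') :
    IsSymplecticPair t' t :=
  ⟨fun i j => by linear_combination h.1 j i, fun i => (h.2 i).symm⟩

lemma RKTableau.IsSymplectic.isSymplecticPair {t : RKTableau s} (h : t.IsSymplectic) :
    IsSymplecticPair t t :=
  ⟨h, fun _ => rfl⟩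

lemma IsSymplecticPair.bilin_sum_sum {t t' : RKTableau s} (ht : IsSymplecticPair t t')
    {E F G : Type*} [AddCommGroup E] [Module ℝ E] [AddCommGroup F] [Module ℝ F] [AddCommGroup G]
    [Module ℝ G] (B : E →ₗ[ℝ] F →ₗ[ℝ] G) (e : Fin s → E) (e' : Fin s → F) :
    B (∑ i, t.b i • e i) (∑ j, t'.b j • e' j) =
      ∑ i, t.b i • (B (e i) (∑ j, t'.a i j • e' j) + B (∑ j, t.a i j • e j) (e' i)) := by
  simp only [map_sum, map_smul, LinearMap.sum_apply, LinearMap.smul_apply, smul_add,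
    Finset.sum_add_distrib, Finset.smul_sum]
  rw [Finset.sum_comm (f := fun i j => t.b i • t.a i j • B (e j) (e' i)),
    ← Finset.sum_add_distrib, Finset.sum_comm]
  refine Finset.sum_congr rfl fun i _ => ?_
  rw [← Finset.sum_add_distrib]
  refine Finset.sum_congr rfl fun j _ => ?_
  rw [smul_smul, smul_smul, smul_smul, ← add_smul, ← ht.2 j, mul_comm, ht.1 i j, ht.2 j]

theorem IsSymplecticPair.bilin_update {t t' : RKTableau s} (ht : IsSymplecticPair t t')
    {E F G : Type*} [AddCommGroup E] [Module ℝ E] [AddCommGroup F] [Module ℝ F] [AddCommGroup G]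
    [Module ℝ G] (B : E →ₗ[ℝ] F →ₗ[ℝ] G) {h : ℝ} {u : E} {v : F} {e ξ : Fin s → E}
    {e' η : Fin s → F} (hξ : ∀ i, ξ i = u + h • ∑ j, t.a i j • e j)
    (hη : ∀ i, η i = v + h • ∑ j, t'.a i j • e' j) :
    B (u + h • ∑ i, t.b i • e i) (v + h • ∑ i, t'.b i • e' i) =
      B u v + h • ∑ i, t.b i • (B (e i) (η i) + B (ξ i) (e' i)) := by
  have hexpand : ∑ i, t.b i • (B (e i) (η i) + B (ξ i) (e' i)) =
      B (∑ i, t.b i • e i) v + B u (∑ i, t'.b i • e' i) +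
        h • B (∑ i, t.b i • e i) (∑ j, t'.b j • e' j) := by
    rw [ht.bilin_sum_sum B]
    simp only [hξ, hη, map_add, map_smul, LinearMap.add_apply, LinearMap.smul_apply, map_sum,
      LinearMap.sum_apply, ht.2, Finset.smul_sum, ← Finset.sum_add_distrib]
    refine Finset.sum_congr rfl fun i _ => ?_
    simp only [smul_add, Finset.smul_sum, smul_comm h, Finset.sum_add_distrib]
    abel
  rw [hexpand]
  simp only [map_add, map_smul, LinearMap.add_apply, LinearMap.smul_apply]
  module

namespace PRKMethod

/-- The discrete Leibniz rule for the form `B` along a step of the method `T` with weights `b`. It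
is stated for arbitrary vectors `F i`, `G i` in place of the values of a vector field at the stages,
so that it applies to the steps themselves and to their linearizations. -/
def Leibniz (T : PRKMethod s) (b : Fin s → ℝ) (B : SpaceN n m → SpaceN n m → ℝ) : Prop :=
  ∀ (h : ℝ) (u v : SpaceN n m) (F G ξ η : Fin s → SpaceN n m),
    ξ = (fun _ => u) + (h • T.stageLin) F → η = (fun _ => v) + (h • T.stageLin) G →
    B (u + h • T.updateLin F) (v + h • T.updateLin G) =
      B u v + h * ∑ i, b i * (B (F i) (η i) + B (ξ i) (G i))

/-- The method `T` acts on the component `ℓ` as the Runge–Kutta method `t`. -/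
structure IntegratesWith {E : Type*} [AddCommGroup E] [Module ℝ E] (T : PRKMethod s)
    (ℓ : SpaceN n m →ₗ[ℝ] E) (t : RKTableau s) : Prop where
  scale_a : ∀ i j v, ℓ (scaleN (T.tz.a i j) (T.tp.a i j) (T.tq.a i j) v) = t.a i j • ℓ v
  scale_b : ∀ i v, ℓ (scaleN (T.tz.b i) (T.tp.b i) (T.tq.b i) v) = t.b i • ℓ v

variable {T : PRKMethod s} {b : Fin s → ℝ} {B B' : SpaceN n m → SpaceN n m → ℝ}

lemma Leibniz.add (hB : T.Leibniz b B) (hB' : T.Leibniz b B') :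
    T.Leibniz b fun u v => B u v + B' u v := by
  intro h u v F G ξ η hξ hη
  simp only [hB h u v F G ξ η hξ hη, hB' h u v F G ξ η hξ hη, mul_add, Finset.sum_add_distrib]
  ring

lemma Leibniz.sub (hB : T.Leibniz b B) (hB' : T.Leibniz b B') :
    T.Leibniz b fun u v => B u v - B' u v := by
  intro h u v F G ξ η hξ hη
  simp only [hB h u v F G ξ η hξ hη, hB' h u v F G ξ η hξ hη, mul_add, mul_sub,
    Finset.sum_add_distrib, Finset.sum_sub_distrib]
  ring

lemma Leibniz.sum {ι : Type*} [Fintype ι] {B : ι → SpaceN n m → SpaceN n m → ℝ}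
    (hB : ∀ k, T.Leibniz b (B k)) : T.Leibniz b fun u v => ∑ k, B k u v := by
  intro h u v F G ξ η hξ hη
  simp only [fun k => hB k h u v F G ξ η hξ hη, Finset.sum_add_distrib, ← Finset.mul_sum]
  rw [Finset.sum_comm]
  simp only [← Finset.mul_sum, Finset.sum_add_distrib]

lemma leibniz_of_integratesWith {E F : Type*} [AddCommGroup E] [Module ℝ E] [AddCommGroup F]
    [Module ℝ F] {ℓ : SpaceN n m →ₗ[ℝ] E} {ℓ' : SpaceN n m →ₗ[ℝ] F} {t t' : RKTableau s}
    (ht : IsSymplecticPair t t') (hℓ : T.IntegratesWith ℓ t) (hℓ' : T.IntegratesWith ℓ' t')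
    (B : E →ₗ[ℝ] F →ₗ[ℝ] ℝ) : T.Leibniz t.b fun u v => B (ℓ u) (ℓ' v) := by
  rintro h u v F G _ _ rfl rfl
  have hupdate := ht.bilin_update B (h := h) (u := ℓ u) (v := ℓ' v) (e := ℓ ∘ F) (e' := ℓ' ∘ G)
    (fun _ => rfl) (fun _ => rfl)
  simpa only [T.updateLin_apply, Pi.add_apply, smul_apply, Pi.smul_apply, T.stageLin_apply,
    map_add, map_smul, map_sum, hℓ.scale_a, hℓ.scale_b, hℓ'.scale_a, hℓ'.scale_b,
    Function.comp_apply, smul_eq_mul] using hupdate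

lemma integratesWith_z₁ (T : PRKMethod s) (j : Fin n) :
    T.IntegratesWith (n := n) (m := m) (LinearMap.proj j ∘ₗ LinearMap.fst ℝ _ _) T.tz :=
  ⟨fun _ _ _ => rfl, fun _ _ => rfl⟩

lemma integratesWith_z₂ (T : PRKMethod s) (j : Fin n) :
    T.IntegratesWith (n := n) (m := m)
      (LinearMap.proj j ∘ₗ LinearMap.fst ℝ _ _ ∘ₗ LinearMap.snd ℝ _ _) T.tz :=
  ⟨fun _ _ _ => rfl, fun _ _ => rfl⟩

lemma integratesWith_p (T : PRKMethod s) (i : Fin m) :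
    T.IntegratesWith (n := n) (m := m)
      (LinearMap.proj i ∘ₗ LinearMap.fst ℝ _ _ ∘ₗ LinearMap.snd ℝ _ _ ∘ₗ LinearMap.snd ℝ _ _)
      T.tp :=
  ⟨fun _ _ _ => rfl, fun _ _ => rfl⟩

lemma integratesWith_q (T : PRKMethod s) (i : Fin m) :
    T.IntegratesWith (n := n) (m := m)
      (LinearMap.proj i ∘ₗ LinearMap.snd ℝ _ _ ∘ₗ LinearMap.snd ℝ _ _ ∘ₗ LinearMap.snd ℝ _ _)
      T.tq :=
  ⟨fun _ _ _ => rfl, fun _ _ => rfl⟩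

/-- The canonical symplectic form of `ℂ`, with the imaginary part as position. -/
def omegaC : ℂ →ₗ[ℝ] ℂ →ₗ[ℝ] ℝ :=
  LinearMap.mk₂ ℝ (fun u v => u.im * v.re - u.re * v.im)
    (fun _ _ _ => by simp only [Complex.add_im, Complex.add_re]; ring)
    (fun _ _ _ => by simp only [Complex.smul_im, Complex.smul_re, smul_eq_mul]; ring)
    (fun _ _ _ => by simp only [Complex.add_im, Complex.add_re]; ring)
    (fun _ _ _ => by simp only [Complex.smul_im, Complex.smul_re, smul_eq_mul]; ring)

lemma leibniz_omegaN (hz : T.tz.IsSymplectic) (hpq : IsSymplecticPair T.tp T.tq)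
    (hb : ∀ i, T.tz.b i = T.tq.b i) : T.Leibniz T.tq.b (omegaN (n := n) (m := m)) := by
  obtain hb : T.tz.b = T.tq.b := funext hb
  obtain hpb : T.tp.b = T.tq.b := (funext hpq.2).symm
  refine .add (.add (.sum fun j => ?_) (.sum fun j => ?_)) (.sum fun i => .sub ?_ ?_)
  · exact hb ▸ leibniz_of_integratesWith hz.isSymplecticPair (T.integratesWith_z₁ j)
      (T.integratesWith_z₁ j) omegaC
  · exact hb ▸ leibniz_of_integratesWith hz.isSymplecticPair (T.integratesWith_z₂ j)
      (T.integratesWith_z₂ j) omegaC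
  · exact leibniz_of_integratesWith hpq.symm (T.integratesWith_q i) (T.integratesWith_p i)
      (LinearMap.mul ℝ ℝ)
  · exact hpb ▸ leibniz_of_integratesWith hpq (T.integratesWith_p i) (T.integratesWith_q i)
      (LinearMap.mul ℝ ℝ)

theorem IsIntegrator.isSymplecticOnN (hz : T.tz.IsSymplectic)
    (hpq : IsSymplecticPair T.tp T.tq) (hb : ∀ i, T.tz.b i = T.tq.b i) {K : SpaceN n m → ℝ} {h : ℝ}
    {Ω V : Set (SpaceN n m)} {Y : SpaceN n m → Fin s → SpaceN n m} (hΩ : IsOpen Ω)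
    (hK : ContDiffOn ℝ 2 K Ω) (hV : IsOpen V) (hI : T.IsIntegrator h (hamVectorField K) Ω V Y) :
    IsSymplecticOnN (fun x => T.update h (hamVectorField K) x (Y x)) V := by
  have hf : ContDiffOn ℝ 1 (hamVectorField K) Ω :=
    contDiffOn_hamVectorField hΩ (hK.of_le (by norm_num))
  intro x hx
  refine ⟨(hI.contDiffAt_update hΩ hV one_ne_zero hf hx).differentiableAt one_ne_zero,
    fun u v => ?_⟩
  obtain ⟨ξ, hξ, hu⟩ := hI.exists_fderiv_update_eq hΩ hV hf hx u
  obtain ⟨η, hη, hv⟩ := hI.exists_fderiv_update_eq hΩ hV hf hx v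
  have hinfinitesimal : ∀ i, omegaN (fderiv ℝ (hamVectorField K) (Y x i) (ξ i)) (η i) +
      omegaN (ξ i) (fderiv ℝ (hamVectorField K) (Y x i) (η i)) = 0 := fun i =>
    omegaN_fderiv_hamVectorField (hK.contDiffAt (hΩ.mem_nhds (hI.mem_domain x hx i))) _ _
  rw [hu, hv, leibniz_omegaN hz hpq hb h u v _ _ ξ η hξ hη]
  simp only [hinfinitesimal, mul_zero, Finset.sum_const_zero, add_zero]

end PRKMethod

/-! ### The Hopf map and the torus action -/

lemma hopf_zero (z₁ z₂ : ℂ) : hopf z₁ z₂ 0 = (z₁.re * z₂.re + z₁.im * z₂.im) / 2 := by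
  simp only [hopf, Complex.star_def, Complex.mul_re, Complex.conj_re, Complex.conj_im,
    Matrix.cons_val]
  ring

lemma hopf_one (z₁ z₂ : ℂ) : hopf z₁ z₂ 1 = (z₁.im * z₂.re - z₁.re * z₂.im) / 2 := by
  simp only [hopf, Complex.star_def, Complex.mul_im, Complex.conj_re, Complex.conj_im,
    Matrix.cons_val]
  ring

lemma hopf_two (z₁ z₂ : ℂ) :
    hopf z₁ z₂ 2 = (z₁.re * z₁.re + z₁.im * z₁.im - (z₂.re * z₂.re + z₂.im * z₂.im)) / 4 := by
  simp only [hopf, Complex.normSq_apply, Matrix.cons_val]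

lemma hopf_eq_iff {z₁ z₂ : ℂ} {w : Fin 3 → ℝ} :
    hopf z₁ z₂ = w ↔ z₁ * star z₂ = 2 * (⟨w 0, w 1⟩ : ℂ) ∧
      Complex.normSq z₁ - Complex.normSq z₂ = 4 * w 2 := by
  rw [show w = ![w 0, w 1, w 2] from (List.ofFn_inj.1 rfl), hopf]
  simp only [RCLike.star_def, Complex.mul_re, Complex.conj_re, Complex.conj_im, mul_neg,
    sub_neg_eq_add, Complex.mul_im, Nat.succ_eq_add_one, Nat.reduceAdd, Fin.isValue,
    Matrix.vecCons_inj, and_true, Matrix.cons_val_zero, Matrix.cons_val_one, Complex.ext_iff,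
    Complex.re_ofNat, Complex.im_ofNat, zero_mul, sub_zero, add_zero, Matrix.cons_val]
  constructor
  · rintro ⟨h0, h1, h2⟩
    refine ⟨⟨?_, ?_⟩, ?_⟩ <;> linarith
  · rintro ⟨⟨h0, h1⟩, h2⟩
    refine ⟨?_, ?_, ?_⟩ <;> linarith

lemma hopf_dotProduct_self (z₁ z₂ : ℂ) :
    hopf z₁ z₂ ⬝ᵥ hopf z₁ z₂ = ((Complex.normSq z₁ + Complex.normSq z₂) / 4) ^ 2 := by
  simp only [dotProduct, Fin.sum_univ_three, hopf_zero, hopf_one, hopf_two, Complex.normSq_apply]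
  ring

lemma normSq_add_normSq_eq (z₁ z₂ : ℂ) :
    Complex.normSq z₁ + Complex.normSq z₂ = 4 * √(hopf z₁ z₂ ⬝ᵥ hopf z₁ z₂) := by
  rw [hopf_dotProduct_self, Real.sqrt_sq (div_nonneg
    (add_nonneg (Complex.normSq_nonneg z₁) (Complex.normSq_nonneg z₂)) zero_le_four)]
  ring

lemma exists_hopf_eq (w : Fin 3 → ℝ) : ∃ z₁ z₂ : ℂ, hopf z₁ z₂ = w := by
  let ζ : ℂ := ⟨w 0, w 1⟩
  obtain ⟨R, hR, hRw⟩ : ∃ R : ℝ, R ^ 2 - w 2 ^ 2 = ‖ζ‖ ^ 2 ∧ |w 2| ≤ R := by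
    refine ⟨√(‖ζ‖ ^ 2 + w 2 ^ 2), ?_, Real.abs_le_sqrt (by nlinarith)⟩
    rw [Real.sq_sqrt (by positivity), add_sub_cancel_right]
  have hadd : 0 ≤ 2 * (R + w 2) := by linarith [neg_abs_le (w 2)]
  have hsub : 0 ≤ 2 * (R - w 2) := by linarith [le_abs_self (w 2)]
  have hnorm : √(2 * (R + w 2)) * √(2 * (R - w 2)) = 2 * ‖ζ‖ := by
    rw [← Real.sqrt_mul hadd, show 2 * (R + w 2) * (2 * (R - w 2)) = (2 * ‖ζ‖) ^ 2 by
      linear_combination 4 * hR, Real.sqrt_sq (by positivity)]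
  refine ⟨√(2 * (R + w 2)) * Complex.exp (ζ.arg * Complex.I), (√(2 * (R - w 2)) : ℝ),
    hopf_eq_iff.2 ⟨?_, ?_⟩⟩
  · rw [Complex.star_def, Complex.conj_ofReal, mul_right_comm, ← Complex.ofReal_mul, hnorm,
      Complex.ofReal_mul, mul_assoc, Complex.norm_mul_exp_arg_mul_I, Complex.ofReal_ofNat]
  · rw [map_mul, Complex.normSq_ofReal, Complex.normSq_ofReal, Complex.normSq_eq_norm_sq,
      Complex.norm_exp_ofReal_mul_I, Real.mul_self_sqrt hadd, Real.mul_self_sqrt hsub]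
    ring

lemma realization_surjective : Function.Surjective (realization (n := n) (m := m)) := fun y => by
  choose z₁ z₂ hz using fun j => exists_hopf_eq (y.1 j)
  exact ⟨(z₁, z₂, y.2.1, y.2.2), Prod.ext (funext hz) rfl⟩

lemma exists_circle_mul_eq {z z' : ℂ} (h : ‖z‖ = ‖z'‖) : ∃ g : Circle, z' = g * z := by
  refine ⟨Circle.exp (z'.arg - z.arg), ?_⟩
  calc z' = ‖z'‖ * Complex.exp (z'.arg * Complex.I) := (Complex.norm_mul_exp_arg_mul_I z').symm
    _ = Complex.exp ((z'.arg - z.arg : ℝ) * Complex.I) *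
        (‖z‖ * Complex.exp (z.arg * Complex.I)) := by
      rw [mul_left_comm, ← Complex.exp_add, ← add_mul, ← Complex.ofReal_add, sub_add_cancel, h]
    _ = Circle.exp (z'.arg - z.arg) * z := by
      rw [Circle.coe_exp, Complex.norm_mul_exp_arg_mul_I]

lemma circle_mul_star_self (g : Circle) : (g : ℂ) * star (g : ℂ) = 1 := by
  rw [Complex.star_def, Complex.mul_conj, Circle.normSq_coe, Complex.ofReal_one]

lemma hopf_circle_mul (g : Circle) (z₁ z₂ : ℂ) : hopf (g * z₁) (g * z₂) = hopf z₁ z₂ := by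
  have hmul : (g * z₁ : ℂ) * star (g * z₂ : ℂ) = z₁ * star z₂ := by
    rw [star_mul']
    linear_combination z₁ * star z₂ * circle_mul_star_self g
  simp only [hopf, hmul, map_mul, Circle.normSq_coe, one_mul]

lemma exists_circle_of_hopf_eq {z₁ z₂ z₁' z₂' : ℂ} (h : hopf z₁ z₂ = hopf z₁' z₂') :
    ∃ g : Circle, z₁' = g * z₁ ∧ z₂' = g * z₂ := by
  have hsum := normSq_add_normSq_eq z₁ z₂
  rw [h, ← normSq_add_normSq_eq] at hsum
  obtain ⟨hmul, hsub⟩ := hopf_eq_iff.1 h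
  obtain ⟨hmul', hsub'⟩ := hopf_eq_iff.1 (rfl : hopf z₁' z₂' = _)
  have hnorm₁ : ‖z₁‖ = ‖z₁'‖ := congrArg Real.sqrt (by linarith)
  have hnorm₂ : ‖z₂‖ = ‖z₂'‖ := congrArg Real.sqrt (by linarith)
  rcases eq_or_ne z₁' 0 with rfl | hz₁'
  · obtain ⟨g, hg⟩ := exists_circle_mul_eq hnorm₂
    obtain rfl : z₁ = 0 := by simpa using hnorm₁
    exact ⟨g, (mul_zero _).symm, hg⟩
  · obtain ⟨g, rfl⟩ := exists_circle_mul_eq hnorm₁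
    refine ⟨g, rfl, star_injective (mul_left_cancel₀ hz₁' ?_)⟩
    rw [hmul', ← hmul, star_mul']
    linear_combination -z₁ * star z₂ * circle_mul_star_self g

/-- The diagonal action of the torus on the `z`-components of `N`; its orbits are the fibres of the
realization. -/
def torusN (g : Fin n → Circle) : SpaceN n m →ₗ[ℝ] SpaceN n m where
  toFun x := (fun j => g j * x.1 j, fun j => g j * x.2.1 j, x.2.2)
  map_add' x y := by ext <;> simp [mul_add]
  map_smul' a x := by ext <;> simp [mul_left_comm]

lemma torusN_apply (g : Fin n → Circle) (x : SpaceN n m) :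
    torusN g x = (fun j => g j * x.1 j, fun j => g j * x.2.1 j, x.2.2) := rfl

lemma torusN_one (x : SpaceN n m) : torusN 1 x = x := by
  simp [torusN_apply]

lemma continuous_torusN :
    Continuous fun a : (Fin n → Circle) × SpaceN n m => torusN a.1 a.2 := by
  simp only [torusN_apply]
  fun_prop

lemma realization_torusN (g : Fin n → Circle) (x : SpaceN n m) :
    realization (torusN g x) = realization x :=
  Prod.ext (funext fun j => hopf_circle_mul (g j) (x.1 j) (x.2.1 j)) rfl

lemma exists_torusN_eq {x x' : SpaceN n m} (h : realization x = realization x') :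
    ∃ g : Fin n → Circle, x' = torusN g x := by
  choose g h₁ h₂ using fun j => exists_circle_of_hopf_eq (congrFun (congrArg Prod.fst h) j)
  exact ⟨g, Prod.ext (funext h₁) (Prod.ext (funext h₂) (congrArg Prod.snd h).symm)⟩

/-! ### Topology of the realization -/

@[fun_prop]
lemma contDiff_re {k : WithTop ℕ∞} : ContDiff ℝ k Complex.re :=
  Complex.reCLM.contDiff

@[fun_prop]
lemma contDiff_im {k : WithTop ℕ∞} : ContDiff ℝ k Complex.im :=
  Complex.imCLM.contDiff

lemma contDiff_realization {k : WithTop ℕ∞} : ContDiff ℝ k (realization (n := n) (m := m)) := by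
  refine ContDiff.prodMk (contDiff_pi.2 fun j => contDiff_pi.2 fun k => ?_) contDiff_snd.snd
  match k with
  | 0 => simp only [hopf_zero]; fun_prop
  | 1 => simp only [hopf_one]; fun_prop
  | 2 => simp only [hopf_two]; fun_prop

lemma continuous_realization : Continuous (realization (n := n) (m := m)) :=
  (contDiff_realization (k := 0)).continuous

lemma norm_le_of_realization (x : SpaceN n m) :
    ‖x‖ ≤ (∑ j, √(4 * √((realization x).1 j ⬝ᵥ (realization x).1 j))) + ‖realization x‖ := by
  have hle (j : Fin n) : √(4 * √((realization x).1 j ⬝ᵥ (realization x).1 j)) ≤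
      (∑ j, √(4 * √((realization x).1 j ⬝ᵥ (realization x).1 j))) + ‖realization x‖ :=
    le_add_of_le_of_nonneg (Finset.single_le_sum
      (f := fun j => √(4 * √((realization x).1 j ⬝ᵥ (realization x).1 j)))
      (fun _ _ => Real.sqrt_nonneg _) (Finset.mem_univ j)) (norm_nonneg _)
  have hz (j : Fin n) : Complex.normSq (x.1 j) + Complex.normSq (x.2.1 j) =
      4 * √((realization x).1 j ⬝ᵥ (realization x).1 j) := normSq_add_normSq_eq _ _
  refine norm_prod_le_iff.2 ⟨?_, norm_prod_le_iff.2 ⟨?_, ?_⟩⟩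
  · refine (pi_norm_le_iff_of_nonneg (by positivity)).2 fun j => le_trans ?_ (hle j)
    exact Real.sqrt_le_sqrt (by linarith [hz j, Complex.normSq_nonneg (x.2.1 j)])
  · refine (pi_norm_le_iff_of_nonneg (by positivity)).2 fun j => le_trans ?_ (hle j)
    exact Real.sqrt_le_sqrt (by linarith [hz j, Complex.normSq_nonneg (x.1 j)])
  · exact le_add_of_nonneg_of_le (by positivity) (norm_snd_le (realization x))

lemma isCompact_realization_preimage {C : Set (SpaceP n m)} (hC : IsCompact C) :
    IsCompact (realization ⁻¹' C) := by
  refine Metric.isCompact_of_isClosed_isBounded (hC.isClosed.preimage continuous_realization) ?_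
  have hcont : Continuous fun y : SpaceP n m => (∑ j, √(4 * √(y.1 j ⬝ᵥ y.1 j))) + ‖y‖ := by
    simp only [dotProduct]
    fun_prop
  obtain ⟨R, hR⟩ := hC.bddAbove_image hcont.continuousOn
  exact isBounded_iff_forall_norm_le.2 ⟨R, fun x hx =>
    (norm_le_of_realization x).trans (hR (Set.mem_image_of_mem _ hx))⟩

lemma isClosedMap_realization : IsClosedMap (realization (n := n) (m := m)) :=
  (isProperMap_iff_isCompact_preimage.2
    ⟨continuous_realization, fun _ hC => isCompact_realization_preimage hC⟩).isClosedMap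

lemma isOpenMap_realization : IsOpenMap (realization (n := n) (m := m)) := by
  intro O hO
  have hsaturation : realization ⁻¹' (realization '' O) =
      ⋃ g : Fin n → Circle, torusN (m := m) g ⁻¹' O := by
    ext x
    simp only [Set.mem_preimage, Set.mem_image, Set.mem_iUnion]
    constructor
    · rintro ⟨x', hx', h⟩
      obtain ⟨g, rfl⟩ := exists_torusN_eq h.symm
      exact ⟨g, hx'⟩
    · rintro ⟨g, hg⟩
      exact ⟨_, hg, realization_torusN g x⟩
  rw [← (isClosedMap_realization.isQuotientMap continuous_realization
    realization_surjective).isOpen_preimage, hsaturation]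
  exact isOpen_iUnion fun g => hO.preimage (continuous_torusN.comp (.prodMk_right g))

theorem PRKMethod.exists_isIntegrator_preimage (T : PRKMethod s)
    {f : SpaceN n m → SpaceN n m} {U : Set (SpaceP n m)} (hU : IsOpen U)
    (hf : ContDiffOn ℝ 1 f (realization ⁻¹' U)) {C : Set (SpaceP n m)} (hC : IsCompact C)
    (hCU : C ⊆ U) {ε : ℝ} (hε : 0 < ε) :
    ∃ h₀ > 0, ∀ h : ℝ, |h| < h₀ →
      ∃ (W : Set (SpaceP n m)) (Y : SpaceN n m → Fin s → SpaceN n m), IsOpen W ∧ C ⊆ W ∧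
        T.IsIntegrator h f (realization ⁻¹' U) (realization ⁻¹' W) Y ∧
        ∀ x ∈ realization ⁻¹' W, ∀ i, dist (Y x i) x < ε := by
  obtain ⟨W, hW, hCW, hWU, hWc⟩ := exists_open_between_and_isCompact_closure hC hU hCU
  obtain ⟨h₀, hh₀, hexists⟩ := T.exists_isIntegrator (hU.preimage continuous_realization) hf
    (isCompact_realization_preimage hWc) (Set.preimage_mono hWU) hε
  refine ⟨h₀, hh₀, fun h hh => ?_⟩
  obtain ⟨Y, hI, hdist⟩ := hexists h hh
  have hsub : realization ⁻¹' W ⊆ realization (n := n) (m := m) ⁻¹' closure W :=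
    Set.preimage_mono subset_closure
  exact ⟨W, Y, hW, hCW, hI.mono hsub, fun x hx => hdist x (hsub hx)⟩

/-! ### Left multiplication by quaternions -/

open scoped Quaternion in
/-- The quaternion `z₁ + j z₂` of a pair of complex numbers. -/
def quaternionEquiv : ℂ × ℂ ≃+ ℍ[ℝ] where
  toFun z := ⟨z.1.re, z.1.im, z.2.re, -z.2.im⟩
  invFun q := (⟨q.re, q.imI⟩, ⟨q.imJ, -q.imK⟩)
  left_inv z := by ext <;> simp
  right_inv q := by ext <;> simp
  map_add' z z' := QuaternionAlgebra.ext rfl rfl rfl (neg_add _ _)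

lemma quaternionEquiv_apply (z : ℂ × ℂ) :
    quaternionEquiv z = ⟨z.1.re, z.1.im, z.2.re, -z.2.im⟩ := rfl

lemma quaternionEquiv_mul (c z : ℂ × ℂ) :
    quaternionEquiv c * quaternionEquiv z =
      quaternionEquiv (c.1 * z.1 - star c.2 * z.2, c.2 * z.1 + star c.1 * z.2) := by
  simp only [quaternionEquiv_apply]
  refine (QuaternionAlgebra.mk_mul_mk _ _ _ _ _ _ _ _).trans ?_
  ext <;> simp <;> ring

/-- Left multiplication of `x ∈ N` by the quaternions `c₁ + j c₂` in the coordinates of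
`c = (c₁, c₂, p, q)`, acting on `z₁ + j z₂`; the `T*ℝᵐ`-component of `x` is replaced by that
of `c`. -/
def mulN (c x : SpaceN n m) : SpaceN n m :=
  (fun j => c.1 j * x.1 j - star (c.2.1 j) * x.2.1 j,
    fun j => c.2.1 j * x.1 j + star (c.1 j) * x.2.1 j, c.2.2)

/-- The unit quaternions, together with the `T*ℝᵐ`-component of `y`. -/
def unitN (y : SpaceP n m) : SpaceN n m :=
  (fun _ => 1, fun _ => 0, y.2)

/-- The imaginary quaternions which generate the rotations of `ℝ³` with angular velocities `v_j`,
together with the `T*ℝᵐ`-component of `v`. -/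
def imagN (v : SpaceP n m) : SpaceN n m :=
  (fun j => ⟨0, v.1 j 2 / 2⟩, fun j => ⟨v.1 j 1 / 2, v.1 j 0 / 2⟩, v.2)

/-- The transformation of `P` induced by `mulN c` under the realization: a quaternion acts on `ℝ³`
by conjugation. -/
def conjP (c : SpaceN n m) (y : SpaceP n m) : SpaceP n m :=
  (fun j =>
    let u : ℂ := y.1 j 0 + y.1 j 1 * Complex.I
    let v : ℂ := c.1 j ^ 2 * u - star (c.2.1 j) ^ 2 * star u
      + 2 * y.1 j 2 * (c.1 j * star (c.2.1 j))
    ![v.re, v.im, (Complex.normSq (c.1 j) - Complex.normSq (c.2.1 j)) * y.1 j 2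
      - 2 * (c.1 j * c.2.1 j * u).re],
    c.2.2)

lemma mulN_mulN (c d x : SpaceN n m) : mulN (mulN c d) x = mulN c (mulN d x) := by
  refine Prod.ext (funext fun j => ?_) (Prod.ext (funext fun j => ?_) rfl) <;>
    simp only [mulN, star_sub, star_add, star_mul', star_star] <;> ring

lemma mulN_unitN (x : SpaceN n m) : mulN (unitN (realization x)) x = x := by
  simp [mulN, unitN, realization]

lemma torusN_mulN (g : Fin n → Circle) (c x : SpaceN n m) :
    torusN g (mulN c x) = mulN c (torusN g x) := by
  refine Prod.ext (funext fun j => ?_) (Prod.ext (funext fun j => ?_) rfl) <;>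
    simp only [mulN, torusN_apply] <;> ring

lemma realization_mulN (c x : SpaceN n m) :
    realization (mulN c x) = conjP c (realization x) := by
  refine Prod.ext (funext fun j => funext fun k => ?_) rfl
  fin_cases k <;>
    simp [realization, mulN, conjP, hopf, Complex.normSq_apply, sq] <;> ring

/-- The linear map `c ↦ mulN c x`. -/
def mulRightN (x : SpaceN n m) : SpaceN n m →L[ℝ] SpaceN n m :=
  LinearMap.toContinuousLinearMap
    { toFun := fun c => mulN c x
      map_add' := fun c c' => by ext <;> simp [mulN] <;> ring
      map_smul' := fun t c => by ext <;> simp [mulN] <;> ring }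

lemma mulRightN_apply (x c : SpaceN n m) : mulRightN x c = mulN c x := rfl

lemma mulN_add_smul (c x δ : SpaceN n m) (t : ℝ) :
    mulN c (x + t • δ) = mulN c x + t • mulN (c.1, c.2.1, 0) δ := by
  ext <;> simp [mulN] <;> ring

lemma eq_zero_or_eq_zero_of_mulN_eq_zero {c x : SpaceN n m} (h : mulN c x = 0) (j : Fin n) :
    (c.1 j = 0 ∧ c.2.1 j = 0) ∨ (x.1 j = 0 ∧ x.2.1 j = 0) := by
  have hmul : quaternionEquiv (c.1 j, c.2.1 j) * quaternionEquiv (x.1 j, x.2.1 j) = 0 := by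
    rw [quaternionEquiv_mul, EmbeddingLike.map_eq_zero_iff]
    exact Prod.ext (congrFun (congrArg Prod.fst h) j)
      (congrFun (congrArg (fun a => a.2.1) h) j)
  simpa only [mul_eq_zero, EmbeddingLike.map_eq_zero_iff, Prod.mk_eq_zero] using hmul

lemma exists_mulN_eq {x y : SpaceN n m}
    (h : ∀ j, x.1 j = 0 → x.2.1 j = 0 → y.1 j = 0 ∧ y.2.1 j = 0) : ∃ c, mulN c x = y := by
  have hquaternion (j : Fin n) : ∃ c : ℂ × ℂ,
      (c.1 * x.1 j - star c.2 * x.2.1 j, c.2 * x.1 j + star c.1 * x.2.1 j) =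
        (y.1 j, y.2.1 j) := by
    refine ⟨quaternionEquiv.symm
      (quaternionEquiv (y.1 j, y.2.1 j) / quaternionEquiv (x.1 j, x.2.1 j)), ?_⟩
    refine quaternionEquiv.injective ((quaternionEquiv_mul _ (x.1 j, x.2.1 j)).symm.trans ?_)
    rw [AddEquiv.apply_symm_apply, div_mul_cancel_of_imp fun hx => ?_]
    simp only [EmbeddingLike.map_eq_zero_iff, Prod.mk_eq_zero] at hx ⊢
    exact h j hx.1 hx.2
  choose c hc using hquaternion
  exact ⟨(fun j => (c j).1, fun j => (c j).2, y.2.2),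
    Prod.ext (funext fun j => congrArg Prod.fst (hc j))
      (Prod.ext (funext fun j => congrArg Prod.snd (hc j)) rfl)⟩

@[fun_prop]
lemma contDiff_star_complex {k : WithTop ℕ∞} : ContDiff ℝ k (star : ℂ → ℂ) :=
  Complex.conjCLE.contDiff

@[fun_prop]
lemma contDiff_ofReal {k : WithTop ℕ∞} : ContDiff ℝ k Complex.ofReal :=
  Complex.ofRealCLM.contDiff

lemma contDiff_mulN {k : WithTop ℕ∞} :
    ContDiff ℝ k fun a : SpaceN n m × SpaceN n m => mulN a.1 a.2 := by
  unfold mulN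
  fun_prop

lemma contDiff_imagN {k : WithTop ℕ∞} : ContDiff ℝ k (imagN (n := n) (m := m)) := by
  unfold imagN
  simp only [Complex.mk_eq_add_mul_I]
  fun_prop

lemma contDiff_unitN {k : WithTop ℕ∞} : ContDiff ℝ k (unitN (n := n) (m := m)) := by
  unfold unitN
  fun_prop

lemma contDiff_conjP {k : WithTop ℕ∞} :
    ContDiff ℝ k fun a : SpaceN n m × SpaceP n m => conjP a.1 a.2 := by
  refine ContDiff.prodMk (contDiff_pi.2 fun j => contDiff_pi.2 fun i => ?_) (by fun_prop)
  fin_cases i <;>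
    simp only [Fin.zero_eta, Fin.mk_one, Fin.reduceFinMk, Matrix.cons_val, Complex.normSq_apply] <;>
    fun_prop

/-! ### The realization is a Poisson map -/

/-- The differential of the Hopf map at `(z₁, z₂)`. -/
def dHopf (z₁ z₂ ζ₁ ζ₂ : ℂ) : Fin 3 → ℝ :=
  ![(z₁.re * ζ₂.re + ζ₁.re * z₂.re + z₁.im * ζ₂.im + ζ₁.im * z₂.im) / 2,
    (z₁.im * ζ₂.re + ζ₁.im * z₂.re - z₁.re * ζ₂.im - ζ₁.re * z₂.im) / 2,
    (z₁.re * ζ₁.re + z₁.im * ζ₁.im - z₂.re * ζ₂.re - z₂.im * ζ₂.im) / 2]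

/-- The differential of the realization at `x`. -/
def dRealization (x ξ : SpaceN n m) : SpaceP n m :=
  (fun j => dHopf (x.1 j) (x.2.1 j) (ξ.1 j) (ξ.2.1 j), ξ.2.2)

lemma hopf_add_smul (z₁ z₂ ζ₁ ζ₂ : ℂ) (t : ℝ) :
    hopf (z₁ + t • ζ₁) (z₂ + t • ζ₂) =
      hopf z₁ z₂ + t • dHopf z₁ z₂ ζ₁ ζ₂ + t ^ 2 • hopf ζ₁ ζ₂ := by
  ext k
  fin_cases k <;>
    simp only [Fin.zero_eta, Fin.mk_one, Fin.reduceFinMk, Pi.add_apply, Pi.smul_apply, hopf_zero,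
      hopf_one, hopf_two, dHopf, Matrix.cons_val, Complex.add_re, Complex.add_im, Complex.smul_re,
      Complex.smul_im, smul_eq_mul] <;>
    ring

lemma differentiable_realization : Differentiable ℝ (realization (n := n) (m := m)) :=
  contDiff_realization.differentiable one_ne_zero

lemma fderiv_realization (x ξ : SpaceN n m) : fderiv ℝ realization x ξ = dRealization x ξ :=
  fderiv_apply_of_quadratic (b := (fun j => hopf (ξ.1 j) (ξ.2.1 j), 0))
    (differentiable_realization x) fun t => Prod.ext
      (funext fun j => hopf_add_smul (x.1 j) (x.2.1 j) (ξ.1 j) (ξ.2.1 j) t)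
      (by simp [realization, dRealization, Prod.ext_iff])

/-- The coefficients `(∂/∂w, -∂/∂q, ∂/∂p)` of a covector on `P`. -/
def coeffP : (SpaceP n m →L[ℝ] ℝ) →L[ℝ] SpaceP n m :=
  let ev (u : SpaceP n m) : (SpaceP n m →L[ℝ] ℝ) →L[ℝ] ℝ := .apply ℝ ℝ u
  .prod (.pi fun j => .pi fun k => ev (Pi.single j (Pi.single k 1), 0, 0))
    (.prod (.pi fun i => -ev (0, 0, Pi.single i 1)) (.pi fun i => ev (0, Pi.single i 1, 0)))

lemma covectorP_apply (α : SpaceP n m →L[ℝ] ℝ) (u : SpaceP n m) :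
    α u = (∑ j, u.1 j ⬝ᵥ (coeffP α).1 j)
      + ∑ i, (u.2.1 i * (coeffP α).2.2 i - u.2.2 i * (coeffP α).2.1 i) := by
  have hu : u = (∑ j, ∑ k, u.1 j k • ((Pi.single j (Pi.single k 1), 0, 0) : SpaceP n m))
      + ∑ i, (u.2.1 i • ((0, Pi.single i 1, 0) : SpaceP n m)
          + u.2.2 i • ((0, 0, Pi.single i 1) : SpaceP n m)) := by
    ext <;> simp [Prod.fst_sum, Prod.snd_sum, Finset.sum_apply, Pi.single_apply]
  conv_lhs => rw [hu]
  simp only [map_add, map_sum, map_smul]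
  simp [coeffP, dotProduct]

lemma omegaN_mulN_imagN (a : SpaceP n m) (x ξ : SpaceN n m) :
    omegaN (mulN (imagN a) x) ξ = (∑ j, (dRealization x ξ).1 j ⬝ᵥ a.1 j)
      + ∑ i, ((dRealization x ξ).2.1 i * a.2.2 i - (dRealization x ξ).2.2 i * a.2.1 i) := by
  rw [omegaN, ← Finset.sum_add_distrib]
  congr 1
  · refine Finset.sum_congr rfl fun j _ => ?_
    simp [dRealization, dHopf, mulN, imagN, dotProduct, Fin.sum_univ_three]
    ring
  · refine Finset.sum_congr rfl fun i _ => ?_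
    simp [dRealization, mulN, imagN]
    ring

lemma sharpN_comp_fderiv_realization (α : SpaceP n m →L[ℝ] ℝ) (x : SpaceN n m) :
    sharpN (α ∘L fderiv ℝ realization x) = mulN (imagN (coeffP α)) x :=
  eq_of_forall_omegaN_eq fun ξ => by
    rw [omegaN_sharpN, ContinuousLinearMap.comp_apply, fderiv_realization, covectorP_apply,
      omegaN_mulN_imagN]

lemma hamVectorField_comp_realization {H : SpaceP n m → ℝ} {x : SpaceN n m}
    (hH : DifferentiableAt ℝ H (realization x)) :
    hamVectorField (H ∘ realization) x =
      mulN (imagN (coeffP (fderiv ℝ H (realization x)))) x := by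
  rw [hamVectorField_eq_sharpN, fderiv_comp x hH (differentiable_realization x),
    sharpN_comp_fderiv_realization]

lemma dRealization_mulN_imagN (a : SpaceP n m) (x : SpaceN n m) :
    dRealization x (mulN (imagN a) x) = (fun j => a.1 j ⨯₃ (realization x).1 j, a.2) := by
  refine Prod.ext (funext fun j => funext fun k => ?_) rfl
  fin_cases k <;>
    simp [dRealization, dHopf, mulN, imagN, realization, crossProduct, hopf_zero, hopf_one,
      hopf_two] <;>
    ring

theorem poissonBracket_realization {f g : SpaceP n m → ℝ} {x : SpaceN n m}
    (hf : DifferentiableAt ℝ f (realization x)) (hg : DifferentiableAt ℝ g (realization x)) :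
    poissonBracket f g (realization x) =
      omegaN (hamVectorField (f ∘ realization) x) (hamVectorField (g ∘ realization) x) := by
  rw [hamVectorField_comp_realization hf, hamVectorField_comp_realization hg, omegaN_mulN_imagN,
    dRealization_mulN_imagN, poissonBracket, add_comm]
  congr 1
  · exact Finset.sum_congr rfl fun j _ =>
      (triple_product_permutation _ _ _).trans (dotProduct_comm _ _)
  · refine Finset.sum_congr rfl fun i _ => ?_
    simp [coeffP, partialP, partialQ]
    ring

lemma omegaN_hamVectorField_comp {Φ : SpaceN n m → SpaceN n m} {x : SpaceN n m}
    (hΦ : DifferentiableAt ℝ Φ x)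
    (hsymp : ∀ u v, omegaN (fderiv ℝ Φ x u) (fderiv ℝ Φ x v) = omegaN u v) {K L : SpaceN n m → ℝ}
    (hK : DifferentiableAt ℝ K (Φ x)) (hL : DifferentiableAt ℝ L (Φ x)) :
    omegaN (hamVectorField (K ∘ Φ) x) (hamVectorField (L ∘ Φ) x) =
      omegaN (hamVectorField K (Φ x)) (hamVectorField L (Φ x)) := by
  have hinj : Function.Injective (fderiv ℝ Φ x : SpaceN n m →ₗ[ℝ] SpaceN n m) := fun u u' h =>
    eq_of_forall_omegaN_eq fun v => by
      rw [← hsymp u v, ← hsymp u' v]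
      exact congrArg (omegaN · _) h
  have hpush : fderiv ℝ Φ x (hamVectorField (L ∘ Φ) x) = hamVectorField L (Φ x) :=
    eq_of_forall_omegaN_eq fun v => by
      obtain ⟨v, rfl⟩ := LinearMap.surjective_of_injective hinj v
      rw [ContinuousLinearMap.coe_coe, hsymp, hamVectorField_eq_sharpN, hamVectorField_eq_sharpN,
        omegaN_sharpN, omegaN_sharpN, fderiv_comp x hL hΦ, ContinuousLinearMap.comp_apply]
  rw [← hpush, hamVectorField_eq_sharpN, hamVectorField_eq_sharpN K, omegaN_sharpN, omegaN_sharpN,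
    fderiv_comp x hK hΦ, ContinuousLinearMap.comp_apply]

/-! ### The leaf `M` -/

lemma hopf_dotProduct_dHopf (z₁ z₂ ζ₁ ζ₂ : ℂ) :
    hopf z₁ z₂ ⬝ᵥ dHopf z₁ z₂ ζ₁ ζ₂ =
      (Complex.normSq z₁ + Complex.normSq z₂) / 8 * (star z₁ * ζ₁ + star z₂ * ζ₂).re := by
  simp only [dotProduct, Fin.sum_univ_three, hopf_zero, hopf_one, hopf_two, dHopf,
    Matrix.cons_val, Complex.normSq_apply, Complex.star_def, Complex.add_re, Complex.mul_re,
    Complex.conj_re, Complex.conj_im]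
  ring

lemma hopf_dotProduct_cross_dHopf (z₁ z₂ ζ₁ ζ₂ η₁ η₂ : ℂ) :
    hopf z₁ z₂ ⬝ᵥ (dHopf z₁ z₂ ζ₁ ζ₂ ⨯₃ dHopf z₁ z₂ η₁ η₂) =
      (Complex.normSq z₁ + Complex.normSq z₂) / 16 *
        ((Complex.normSq z₁ + Complex.normSq z₂) *
            ((ζ₁.im * η₁.re - ζ₁.re * η₁.im) + (ζ₂.im * η₂.re - ζ₂.re * η₂.im))
          + ((star z₁ * ζ₁ + star z₂ * ζ₂).re * (star z₁ * η₁ + star z₂ * η₂).im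
            - (star z₁ * ζ₁ + star z₂ * ζ₂).im * (star z₁ * η₁ + star z₂ * η₂).re)) := by
  simp only [dotProduct, Fin.sum_univ_three, cross_apply, hopf_zero, hopf_one, hopf_two, dHopf,
    Matrix.cons_val, Complex.normSq_apply, Complex.star_def, Complex.add_re, Complex.mul_re,
    Complex.add_im, Complex.mul_im, Complex.conj_re, Complex.conj_im]
  ring

lemma hopf_dotProduct_cross_dHopf_of_tangent {z₁ z₂ ζ₁ ζ₂ η₁ η₂ : ℂ}
    (hz : hopf z₁ z₂ ⬝ᵥ hopf z₁ z₂ = 1) (hζ : hopf z₁ z₂ ⬝ᵥ dHopf z₁ z₂ ζ₁ ζ₂ = 0)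
    (hη : hopf z₁ z₂ ⬝ᵥ dHopf z₁ z₂ η₁ η₂ = 0) :
    hopf z₁ z₂ ⬝ᵥ (dHopf z₁ z₂ ζ₁ ζ₂ ⨯₃ dHopf z₁ z₂ η₁ η₂) =
      (ζ₁.im * η₁.re - ζ₁.re * η₁.im) + (ζ₂.im * η₂.re - ζ₂.re * η₂.im) := by
  have hnorm : Complex.normSq z₁ + Complex.normSq z₂ = 4 := by
    rw [normSq_add_normSq_eq, hz, Real.sqrt_one, mul_one]
  have hre {ζ₁ ζ₂ : ℂ} (hζ : hopf z₁ z₂ ⬝ᵥ dHopf z₁ z₂ ζ₁ ζ₂ = 0) :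
      (star z₁ * ζ₁ + star z₂ * ζ₂).re = 0 := by
    rw [hopf_dotProduct_dHopf, hnorm] at hζ
    linarith
  rw [hopf_dotProduct_cross_dHopf, hnorm, hre hζ, hre hη]
  ring

lemma omegaM_dRealization {x ξ η : SpaceN n m} (hx : realization x ∈ spaceM n m)
    (hξ : dRealization x ξ ∈ tangentM (realization x))
    (hη : dRealization x η ∈ tangentM (realization x)) :
    omegaM (realization x) (dRealization x ξ) (dRealization x η) = omegaN ξ η := by
  rw [omegaM, omegaN, add_comm, ← Finset.sum_add_distrib]
  congr 1
  exact Finset.sum_congr rfl fun j _ =>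
    hopf_dotProduct_cross_dHopf_of_tangent (hx j) (hξ j) (hη j)

lemma exists_dRealization_eq {x : SpaceN n m} (hx : realization x ∈ spaceM n m)
    {u : SpaceP n m} (hu : u ∈ tangentM (realization x)) : ∃ ξ, dRealization x ξ = u := by
  refine ⟨mulN (imagN (fun j => (realization x).1 j ⨯₃ u.1 j, u.2)) x, ?_⟩
  rw [dRealization_mulN_imagN]
  refine Prod.ext (funext fun j => ?_) rfl
  dsimp only
  rw [cross_cross_eq_smul_sub_smul, hx j, dotProduct_comm, hu j, one_smul, zero_smul, sub_zero]

lemma fderiv_dotProduct_self {E ι : Type*} [NormedAddCommGroup E] [NormedSpace ℝ E] [Fintype ι]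
    {F : E → ι → ℝ} {x : E} (hF : DifferentiableAt ℝ F x) (u : E) :
    fderiv ℝ (fun x => F x ⬝ᵥ F x) x u = 2 * (F x ⬝ᵥ fderiv ℝ F x u) := by
  have hFk (k : ι) : HasFDerivAt (fun x => F x k) (.proj k ∘L fderiv ℝ F x) x :=
    hasFDerivAt_pi'.1 hF.hasFDerivAt k
  have hsum : HasFDerivAt (fun x => F x ⬝ᵥ F x) _ x :=
    HasFDerivAt.fun_sum (u := Finset.univ) fun k _ => (hFk k).mul (hFk k)
  rw [hsum.fderiv]
  simp [dotProduct, Finset.mul_sum, two_mul]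

lemma PreservesLeavesOn.fderiv_mem_tangentM {φ : SpaceP n m → SpaceP n m} {W : Set (SpaceP n m)}
    (hleaf : PreservesLeavesOn φ W) (hW : IsOpen W) {y u : SpaceP n m} (hy : y ∈ W)
    (hφ : DifferentiableAt ℝ φ y) (hu : u ∈ tangentM y) : fderiv ℝ φ y u ∈ tangentM (φ y) := by
  intro j
  let ℓ : SpaceP n m →L[ℝ] Fin 3 → ℝ := .proj j ∘L .fst ℝ _ _
  have hnorm : (fun y => ℓ (φ y) ⬝ᵥ ℓ (φ y)) =ᶠ[𝓝 y] fun y => ℓ y ⬝ᵥ ℓ y := by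
    filter_upwards [hW.mem_nhds hy] with y' hy' using hleaf y' hy' j
  have hfderiv := DFunLike.congr_fun (hnorm.fderiv_eq (𝕜 := ℝ)) u
  rw [fderiv_dotProduct_self (F := fun y => ℓ (φ y)) (ℓ.differentiableAt.comp y hφ),
    fderiv_dotProduct_self ℓ.differentiableAt, ℓ.fderiv, ← Function.comp_def ℓ φ,
    fderiv_comp y ℓ.differentiableAt hφ, ℓ.fderiv] at hfderiv
  have hzero : y.1 j ⬝ᵥ u.1 j = 0 := hu j
  simpa [ℓ, hzero] using hfderiv

/-! ### Maps of `P` covered by maps of `N` -/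

/-- `Φ` descends to `φ` over `W ⊆ P`. -/
def DescendsOn (Φ : SpaceN n m → SpaceN n m) (φ : SpaceP n m → SpaceP n m)
    (W : Set (SpaceP n m)) : Prop :=
  ∀ x ∈ realization ⁻¹' W, φ (realization x) = realization (Φ x)

lemma exists_descendsOn {Φ : SpaceN n m → SpaceN n m} {W : Set (SpaceP n m)}
    (h : ∀ x ∈ realization ⁻¹' W, ∀ x', realization x = realization x' →
      realization (Φ x) = realization (Φ x')) : ∃ φ, DescendsOn Φ φ W :=
  ⟨fun y => realization (Φ (Function.surjInv realization_surjective y)), fun x hx =>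
    (h x hx _ (Function.surjInv_eq realization_surjective _).symm).symm⟩

namespace DescendsOn

variable {Φ : SpaceN n m → SpaceN n m} {φ : SpaceP n m → SpaceP n m} {W : Set (SpaceP n m)}
  {x : SpaceN n m}

lemma eventuallyEq (h : DescendsOn Φ φ W) (hW : IsOpen W) (hx : realization x ∈ W) :
    φ ∘ realization =ᶠ[𝓝 x] realization ∘ Φ := by
  filter_upwards [(hW.preimage continuous_realization).mem_nhds hx] with x' hx' using h x' hx'

lemma contDiffOn {r : WithTop ℕ∞} (h : DescendsOn Φ φ W) (hW : IsOpen W)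
    (hκ : ∀ x ∈ realization ⁻¹' W, ∃ κ, ContDiffAt ℝ r κ (realization x) ∧
      κ ∘ realization =ᶠ[𝓝 x] realization ∘ Φ) : ContDiffOn ℝ r φ W := by
  intro y hy
  obtain ⟨x, rfl⟩ := realization_surjective y
  obtain ⟨κ, hκC, hκx⟩ := hκ x hy
  exact (hκC.congr_of_eventuallyEq (isOpenMap_realization.nhds_le x
    (eventually_map.2 ((h.eventuallyEq hW hy).trans hκx.symm)))).contDiffWithinAt

lemma fderiv_dRealization (h : DescendsOn Φ φ W) (hW : IsOpen W) (hx : realization x ∈ W)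
    (hφ : DifferentiableAt ℝ φ (realization x)) (hΦ : DifferentiableAt ℝ Φ x) (ξ : SpaceN n m) :
    fderiv ℝ φ (realization x) (dRealization x ξ) = dRealization (Φ x) (fderiv ℝ Φ x ξ) := by
  have hfderiv := DFunLike.congr_fun ((h.eventuallyEq hW hx).fderiv_eq (𝕜 := ℝ)) ξ
  rwa [fderiv_comp x hφ (differentiable_realization x),
    fderiv_comp x (differentiable_realization _) hΦ, ContinuousLinearMap.comp_apply,
    ContinuousLinearMap.comp_apply, fderiv_realization, fderiv_realization] at hfderiv

theorem isPoissonOnP (h : DescendsOn Φ φ W) (hW : IsOpen W)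
    (hφ : ∀ y ∈ W, DifferentiableAt ℝ φ y) (hΦ : IsSymplecticOnN Φ (realization ⁻¹' W)) :
    IsPoissonOnP φ W := by
  refine fun y hy => ⟨hφ y hy, fun f g hf hg => ?_⟩
  obtain ⟨x, rfl⟩ := realization_surjective y
  have hpull (f : SpaceP n m → ℝ) : hamVectorField ((f ∘ φ) ∘ realization) x =
      hamVectorField ((f ∘ realization) ∘ Φ) x := by
    have hev : (f ∘ φ) ∘ realization =ᶠ[𝓝 x] (f ∘ realization) ∘ Φ :=
      (h.eventuallyEq hW hy).fun_comp f
    rw [hamVectorField_eq_sharpN, hamVectorField_eq_sharpN, hev.fderiv_eq]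
  rw [poissonBracket_realization (hf.comp _ (hφ _ hy)) (hg.comp _ (hφ _ hy)), hpull, hpull]
  rw [h x hy] at hf hg ⊢
  rw [poissonBracket_realization hf hg]
  exact omegaN_hamVectorField_comp (hΦ x hy).1 (hΦ x hy).2
    (hf.comp _ (differentiable_realization _)) (hg.comp _ (differentiable_realization _))

lemma preservesLeavesOn (h : DescendsOn Φ φ W) (hΦ : ∀ x ∈ realization ⁻¹' W, ∀ j,
    Complex.normSq ((Φ x).1 j) + Complex.normSq ((Φ x).2.1 j) =
      Complex.normSq (x.1 j) + Complex.normSq (x.2.1 j)) : PreservesLeavesOn φ W := by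
  intro y hy j
  obtain ⟨x, rfl⟩ := realization_surjective y
  rw [h x hy, realization, realization, hopf_dotProduct_self, hopf_dotProduct_self, hΦ x hy j]

theorem restrictsToSymplecticOnM (h : DescendsOn Φ φ W) (hW : IsOpen W)
    (hφ : ∀ y ∈ W, DifferentiableAt ℝ φ y) (hΦ : IsSymplecticOnN Φ (realization ⁻¹' W))
    (hleaf : PreservesLeavesOn φ W) : RestrictsToSymplecticOnM φ W := by
  rintro y ⟨hM, hy⟩
  have hM' : φ y ∈ spaceM n m := fun j => (hleaf y hy j).trans (hM j)
  have htangent : ∀ u ∈ tangentM y, fderiv ℝ φ y u ∈ tangentM (φ y) := fun u hu =>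
    hleaf.fderiv_mem_tangentM hW hy (hφ y hy) hu
  refine ⟨hM', hφ y hy, htangent, fun u hu v hv => ?_⟩
  obtain ⟨x, rfl⟩ := realization_surjective y
  obtain ⟨ξ, rfl⟩ := exists_dRealization_eq hM hu
  obtain ⟨η, rfl⟩ := exists_dRealization_eq hM hv
  have hξ := htangent _ hu
  have hη := htangent _ hv
  rw [h.fderiv_dRealization hW hy (hφ _ hy) (hΦ x hy).1, h x hy] at hξ hη
  rw [h.fderiv_dRealization hW hy (hφ _ hy) (hΦ x hy).1,
    h.fderiv_dRealization hW hy (hφ _ hy) (hΦ x hy).1, h x hy,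
    omegaM_dRealization (h x hy ▸ hM') hξ hη, (hΦ x hy).2, omegaM_dRealization hM hu hv]

end DescendsOn

/-! ### Quadratic invariants -/

lemma PRKMethod.IsIntegrator.quadratic_invariant {T : PRKMethod s} {h : ℝ}
    {f : SpaceN n m → SpaceN n m} {Ω V : Set (SpaceN n m)} {Y : SpaceN n m → Fin s → SpaceN n m}
    {b : Fin s → ℝ} {B : SpaceN n m → SpaceN n m → ℝ} (hI : T.IsIntegrator h f Ω V Y)
    (hB : T.Leibniz b B) (hf : ∀ x ∈ Ω, B (f x) x + B x (f x) = 0) {x : SpaceN n m} (hx : x ∈ V) :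
    B (T.update h f x (Y x)) (T.update h f x (Y x)) = B x x := by
  have hstages := (hI.stage_eq x hx).trans (T.stageMap_eq h f x (Y x))
  have hzero (i : Fin s) : b i * (B (f (Y x i)) (Y x i) + B (Y x i) (f (Y x i))) = 0 := by
    rw [hf _ (hI.mem_domain x hx i), mul_zero]
  rw [T.update_eq, hB h x x _ _ _ _ hstages hstages]
  simp only [Function.comp_apply, hzero, Finset.sum_const_zero, mul_zero, add_zero]

lemma inner_mulN_imagN (v : SpaceP n m) (x : SpaceN n m) (j : Fin n) :
    inner ℝ (x.1 j) ((mulN (imagN v) x).1 j) + inner ℝ (x.2.1 j) ((mulN (imagN v) x).2.1 j) =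
      0 := by
  simp only [mulN, imagN, Complex.inner, Complex.star_def, Complex.mul_re, Complex.mul_im,
    Complex.conj_re, Complex.conj_im, Complex.sub_re, Complex.sub_im, Complex.add_re,
    Complex.add_im]
  ring

theorem PRKMethod.IsIntegrator.normSq_update {T : PRKMethod s} (hz : T.tz.IsSymplectic) {h : ℝ}
    {f : SpaceN n m → SpaceN n m} {Ω V : Set (SpaceN n m)} {Y : SpaceN n m → Fin s → SpaceN n m}
    (hI : T.IsIntegrator h f Ω V Y) (hf : ∀ x ∈ Ω, ∃ v, f x = mulN (imagN v) x) {x : SpaceN n m}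
    (hx : x ∈ V) (j : Fin n) :
    Complex.normSq ((T.update h f x (Y x)).1 j) + Complex.normSq ((T.update h f x (Y x)).2.1 j) =
      Complex.normSq (x.1 j) + Complex.normSq (x.2.1 j) := by
  have hB : T.Leibniz T.tz.b fun u v : SpaceN n m =>
      innerₗ ℂ (u.1 j) (v.1 j) + innerₗ ℂ (u.2.1 j) (v.2.1 j) :=
    (leibniz_of_integratesWith hz.isSymplecticPair (T.integratesWith_z₁ j)
      (T.integratesWith_z₁ j) (innerₗ ℂ)).add
    (leibniz_of_integratesWith hz.isSymplecticPair (T.integratesWith_z₂ j)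
      (T.integratesWith_z₂ j) (innerₗ ℂ))
  have hinv := hI.quadratic_invariant hB (fun x hx => ?_) hx
  · simpa only [innerₗ_apply_apply, real_inner_self_eq_norm_sq, Complex.sq_norm] using hinv
  · obtain ⟨v, hv⟩ := hf x hx
    simp only [innerₗ_apply_apply, hv, real_inner_comm (x.1 j), real_inner_comm (x.2.1 j),
      inner_mulN_imagN, add_zero]

/-! ### Equivariance of the stages -/

section ScaleEquivariant

variable {G : Type*} [FunLike G (SpaceN n m) (SpaceN n m)]
  [LinearMapClass G ℝ (SpaceN n m) (SpaceN n m)] {L : G}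

lemma PRKMethod.stageLin_comp (hL : ∀ α β γ x, L (scaleN α β γ x) = scaleN α β γ (L x))
    (T : PRKMethod s) (h : ℝ) (v : Fin s → SpaceN n m) :
    (h • T.stageLin) (L ∘ v) = L ∘ (h • T.stageLin) v := by
  funext i
  simp only [smul_apply, Pi.smul_apply, T.stageLin_apply, Function.comp_apply, map_smul, map_sum,
    hL]

lemma PRKMethod.update_map (hL : ∀ α β γ x, L (scaleN α β γ x) = scaleN α β γ (L x))
    (T : PRKMethod s) (h : ℝ) {f F : SpaceN n m → SpaceN n m} {S : Fin s → SpaceN n m}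
    (hf : ∀ i, L (F (S i)) = f (L (S i))) (x : SpaceN n m) :
    T.update h f (L x) (L ∘ S) = L (T.update h F x S) := by
  simp only [PRKMethod.update, Function.comp_apply, map_add, map_smul, map_sum, hL, hf]

end ScaleEquivariant

lemma torusN_scaleN (g : Fin n → Circle) (α β γ : ℝ) (x : SpaceN n m) :
    torusN g (scaleN α β γ x) = scaleN α β γ (torusN g x) := by
  simp only [torusN_apply, scaleN, Pi.smul_apply, mul_smul_comm]
  rfl

lemma mulRightN_scaleN (x : SpaceN n m) (α β γ : ℝ) (c : SpaceN n m) :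
    mulRightN x (scaleN α β γ c) = scaleN α β γ (mulRightN x c) := by
  ext <;> simp [mulRightN_apply, mulN, scaleN] <;> ring

/-- `f` commutes with the torus action on the preimage of `U`. -/
def IsTorusEquivariantOn (f : SpaceN n m → SpaceN n m) (U : Set (SpaceP n m)) : Prop :=
  ∀ x ∈ realization ⁻¹' U, ∀ g, torusN g (f x) = f (torusN g x)

namespace IsTorusEquivariantOn

variable {T : PRKMethod s} {h : ℝ} {f : SpaceN n m → SpaceN n m} {U W : Set (SpaceP n m)}
  {Y : SpaceN n m → Fin s → SpaceN n m} {x : SpaceN n m}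

theorem stages_torusN (hf : IsTorusEquivariantOn f U) (hU : IsOpen U)
    (hfU : ContDiffOn ℝ 1 f (realization ⁻¹' U))
    (hI : T.IsIntegrator h f (realization ⁻¹' U) (realization ⁻¹' W) Y)
    (hx : x ∈ realization ⁻¹' W) (g : Fin n → Circle) :
    Y (torusN g x) = torusN g ∘ Y x := by
  have hΩ := hU.preimage (continuous_realization (n := n) (m := m))
  have hW (g : Fin n → Circle) : torusN g x ∈ realization ⁻¹' W := by
    rwa [Set.mem_preimage, realization_torusN]
  have horbit (y : SpaceN n m) : Continuous fun g : Fin n → Circle => torusN g y :=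
    continuous_torusN.comp (continuous_id.prodMk continuous_const)
  refine congrFun (eq_of_comp_eq_of_preconnectedSpace (𝕜 := ℝ) (t₀ := 1)
    (g := stageResidual (h • T.stageLin) f) (y₁ := fun g => Y (torusN g x))
    (y₂ := fun g => torusN g ∘ Y x)
    (fun g => contDiffAt_stageResidual (hI.contDiffAt_vectorField hΩ hfU (hW g)))
    (fun g => hI.bijective_fderiv_stageResidual (hW g))
    (hI.continuousOn.comp_continuous (horbit x) hW)
    (continuous_pi fun i => horbit (Y x i)) (funext fun g => ?_) ?_) g
  · rw [Function.comp_apply, Function.comp_apply, hI.stageResidual_eq (hW g),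
      stageResidual_map (torusN g) (T.stageLin_comp (torusN_scaleN g) h)
        fun i => hf _ (hI.mem_domain x hx i) g, hI.stageResidual_eq hx]
    rfl
  · funext i
    simp only [torusN_one, Function.comp_apply]

lemma stages_eq_zero (hf : IsTorusEquivariantOn f U) (hU : IsOpen U)
    (hfU : ContDiffOn ℝ 1 f (realization ⁻¹' U))
    (hI : T.IsIntegrator h f (realization ⁻¹' U) (realization ⁻¹' W) Y)
    (hx : x ∈ realization ⁻¹' W) {j : Fin n} (h₁ : x.1 j = 0) (h₂ : x.2.1 j = 0) (i : Fin s) :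
    (Y x i).1 j = 0 ∧ (Y x i).2.1 j = 0 := by
  let g : Fin n → Circle := Function.update 1 j (-1)
  have hgj : (g j : ℂ) = -1 := by simp [g]
  have hfix : torusN g x = x := by
    refine Prod.ext (funext fun k => ?_) (Prod.ext (funext fun k => ?_) rfl) <;>
      rcases eq_or_ne k j with rfl | hk <;> simp [torusN_apply, g, *]
  have hstage := congrFun (hf.stages_torusN hU hfU hI hx g) i
  rw [hfix, Function.comp_apply, torusN_apply] at hstage
  have hstage₁ := congrFun (congrArg Prod.fst hstage) j
  have hstage₂ := congrFun (congrArg (fun y => y.2.1) hstage) j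
  simp only [hgj, neg_mul, one_mul] at hstage₁ hstage₂
  exact ⟨self_eq_neg.1 hstage₁, self_eq_neg.1 hstage₂⟩

theorem realization_update_eq (hf : IsTorusEquivariantOn f U) (hU : IsOpen U)
    (hfU : ContDiffOn ℝ 1 f (realization ⁻¹' U))
    (hI : T.IsIntegrator h f (realization ⁻¹' U) (realization ⁻¹' W) Y)
    (hx : x ∈ realization ⁻¹' W) {x' : SpaceN n m} (hxx' : realization x = realization x') :
    realization (T.update h f x (Y x)) = realization (T.update h f x' (Y x')) := by
  obtain ⟨g, rfl⟩ := exists_torusN_eq hxx'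
  rw [hf.stages_torusN hU hfU hI hx g, T.update_map (torusN_scaleN g) h
    (fun i => hf _ (hI.mem_domain x hx i) g), realization_torusN]

end IsTorusEquivariantOn

/-! ### The reduced stage equations -/

/-- The stage equations over the point `y` of `P` for the stages `c_i`, which determine the stages
`Y_i = mulN c_i x` over the points `x` of the fibre of `y`. -/
def reducedField (g : SpaceP n m → SpaceN n m) (y : SpaceP n m) (c : SpaceN n m) : SpaceN n m :=
  mulN (g (conjP c y)) c

lemma contDiffAt_reducedField {g : SpaceP n m → SpaceN n m} {r : WithTop ℕ∞} {y : SpaceP n m}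
    {c : SpaceN n m} (hg : ContDiffAt ℝ r g (conjP c y)) :
    ContDiffAt ℝ r (Function.uncurry (reducedField g)) (y, c) :=
  contDiff_mulN.contDiffAt.comp (y, c) (.prodMk (hg.comp (y, c) (contDiff_conjP.contDiffAt.comp
    (y, c) (contDiffAt_snd.prodMk contDiffAt_fst))) contDiffAt_snd)

lemma continuousAt_mulRightN_comp {c : SpaceP n m → Fin s → SpaceN n m} {x : SpaceN n m}
    (hc : ContinuousAt c (realization x)) :
    ContinuousAt (fun x => mulRightN x ∘ c (realization x)) x :=
  continuousAt_pi.2 fun i =>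
    (contDiff_mulN (k := 0)).continuous.continuousAt.comp (f := fun x => (c (realization x) i, x))
      (((continuous_apply i).continuousAt.comp (hc.comp
        continuous_realization.continuousAt)).prodMk continuousAt_id)

/-- Over `U`, the vector field `f` is multiplication by the quaternions `g`, which depend only on
the point of `P`; Hamiltonian vector fields of pull-backs have this form. -/
def IsLiftOn (f : SpaceN n m → SpaceN n m) (g : SpaceP n m → SpaceN n m)
    (U : Set (SpaceP n m)) : Prop :=
  ∀ x ∈ realization ⁻¹' U, f x = mulN (g (realization x)) x

namespace IsLiftOn

variable {f : SpaceN n m → SpaceN n m} {g : SpaceP n m → SpaceN n m} {U : Set (SpaceP n m)}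

lemma isTorusEquivariantOn (hf : IsLiftOn f g U) : IsTorusEquivariantOn f U := fun x hx t => by
  have htx : torusN t x ∈ realization ⁻¹' U := by rwa [Set.mem_preimage, realization_torusN]
  rw [hf x hx, hf _ htx, torusN_mulN, realization_torusN]

lemma contDiffOn (hf : IsLiftOn f g U) {r : WithTop ℕ∞} (hg : ContDiffOn ℝ r g U) :
    ContDiffOn ℝ r f (realization ⁻¹' U) :=
  (contDiff_mulN.comp_contDiffOn ((hg.comp contDiff_realization.contDiffOn
    (Set.mapsTo_preimage _ _)).prodMk contDiffOn_id)).congr hf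

lemma mulN_reducedField (hf : IsLiftOn f g U) {c x : SpaceN n m}
    (hc : mulN c x ∈ realization ⁻¹' U) :
    mulN (reducedField g (realization x) c) x = f (mulN c x) := by
  rw [hf _ hc, reducedField, mulN_mulN, realization_mulN]

lemma fderiv_apply (hf : IsLiftOn f g U) (hU : IsOpen U) {x δ : SpaceN n m}
    (hx : x ∈ realization ⁻¹' U) (hg : DifferentiableAt ℝ g (realization x))
    (hδ : dRealization x δ = 0) :
    fderiv ℝ f x δ = mulN ((g (realization x)).1, (g (realization x)).2.1, 0) δ := by
  have hev : f =ᶠ[𝓝 x] (fun a : SpaceN n m × SpaceN n m => mulN a.1 a.2) ∘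
      fun x => (g (realization x), x) := by
    filter_upwards [(hU.preimage continuous_realization).mem_nhds hx] with x' hx' using hf x' hx'
  have hmul : DifferentiableAt ℝ (fun a : SpaceN n m × SpaceN n m => mulN a.1 a.2)
      (g (realization x), x) := contDiff_mulN.differentiable one_ne_zero _
  have hgψ := hg.hasFDerivAt.comp x (differentiable_realization x).hasFDerivAt
  have hcomp := HasFDerivAt.comp (f := fun x => (g (realization x), x)) x hmul.hasFDerivAt
    (hgψ.prodMk (hasFDerivAt_id x))
  rw [hev.fderiv_eq, hcomp.fderiv, ContinuousLinearMap.comp_apply, ContinuousLinearMap.prod_apply,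
    ContinuousLinearMap.comp_apply, fderiv_realization, hδ, map_zero]
  exact fderiv_apply_of_quadratic (b := 0) hmul fun t => by
    simpa using mulN_add_smul (g (realization x)) x δ t

lemma isLinearLift (hf : IsLiftOn f g U) (hU : IsOpen U) (hg : ContDiffOn ℝ 1 g U)
    (x : SpaceN n m) :
    IsLinearLift (mulRightN x) (reducedField g (realization x)) f (realization ⁻¹' U) where
  isOpen := hU.preimage continuous_realization
  differentiableAt y hy := (((hf.contDiffOn hg).contDiffAt
    ((hU.preimage continuous_realization).mem_nhds hy)).differentiableAt one_ne_zero)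
  differentiableAt_lift c hc := by
    have hc' : conjP c (realization x) ∈ U := by rwa [← realization_mulN]
    exact ((contDiffAt_reducedField (hg.contDiffAt (hU.mem_nhds hc'))).differentiableAt
      one_ne_zero).comp c ((differentiableAt_const _).prodMk differentiableAt_id)
  map_lift c hc := hf.mulN_reducedField hc
  lift_add c δ hc hδ := by
    rw [mulRightN_apply] at hc
    have hrealization : dRealization (mulN c x) δ = 0 := by
      refine Prod.ext (funext fun j => ?_) (congrArg (fun y => y.2.2) hδ)
      rcases eq_zero_or_eq_zero_of_mulN_eq_zero hδ j with ⟨h₁, h₂⟩ | ⟨h₁, h₂⟩ <;>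
        simp [dRealization, dHopf, mulN, h₁, h₂]
    have hconj : conjP (c + δ) (realization x) = realization (mulN c x) := by
      rw [← realization_mulN, ← mulRightN_apply, map_add, hδ, add_zero, mulRightN_apply]
    rw [mulRightN_apply, hf.fderiv_apply hU hc ((hg.contDiffAt (hU.mem_nhds hc)).differentiableAt
      one_ne_zero) hrealization, reducedField, reducedField, hconj, ← realization_mulN]
    simpa using mulN_add_smul (g (realization (mulN c x))) c δ 1

variable {T : PRKMethod s} {h : ℝ} {W : Set (SpaceP n m)} {Y : SpaceN n m → Fin s → SpaceN n m}
  {x : SpaceN n m}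

lemma exists_reducedStages (hf : IsLiftOn f g U) (hU : IsOpen U) (hg : ContDiffOn ℝ 1 g U)
    (hI : T.IsIntegrator h f (realization ⁻¹' U) (realization ⁻¹' W) Y)
    (hx : x ∈ realization ⁻¹' W) :
    ∃ c : Fin s → SpaceN n m, mulRightN x ∘ c = Y x ∧
      stageResidual (h • T.stageLin) (reducedField g (realization x)) c =
        (fun _ => unitN (realization x)) ∧
      Function.Bijective
        (fderiv ℝ (stageResidual (h • T.stageLin) (reducedField g (realization x))) c) := by
  choose c hc using fun i => exists_mulN_eq fun j h₁ h₂ =>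
    hf.isTorusEquivariantOn.stages_eq_zero hU (hf.contDiffOn hg) hI hx h₁ h₂ i
  have hcY : mulRightN x ∘ c = Y x := funext hc
  have hunit : (fun _ => x) = mulRightN x ∘ fun _ : Fin s => unitN (realization x) :=
    funext fun _ => (mulN_unitN x).symm
  obtain ⟨c', hc', hsol, hreg⟩ := (hf.isLinearLift hU hg x).exists_stages (c := c)
    (u := fun _ => unitN (realization x)) (T.stageLin_comp (mulRightN_scaleN x) h)
    (fun i => by rw [mulRightN_apply, hc]; exact hI.mem_domain x hx i)
    (hcY.symm ▸ hI.bijective_fderiv_stageResidual hx)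
    (by rw [hcY, hI.stageResidual_eq hx]; exact hunit)
  exact ⟨c', hc'.trans hcY, hsol, hreg⟩

lemma stageResidual_mulRightN (hf : IsLiftOn f g U) {c : Fin s → SpaceN n m}
    (hc : ∀ i, mulN (c i) x ∈ realization ⁻¹' U)
    (hsol : stageResidual (h • T.stageLin) (reducedField g (realization x)) c =
      fun _ => unitN (realization x)) :
    stageResidual (h • T.stageLin) f (mulRightN x ∘ c) = fun _ => x := by
  rw [stageResidual_map (mulRightN x) (T.stageLin_comp (mulRightN_scaleN x) h)
    fun i => hf.mulN_reducedField (hc i), hsol]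
  exact funext fun _ => mulN_unitN x

lemma realization_update_mulRightN (hf : IsLiftOn f g U) {c : Fin s → SpaceN n m}
    (hc : ∀ i, mulN (c i) x ∈ realization ⁻¹' U) :
    realization (T.update h f x (mulRightN x ∘ c)) =
      conjP (T.update h (reducedField g (realization x)) (unitN (realization x)) c)
        (realization x) := by
  have hupdate := T.update_map (mulRightN_scaleN x) h (fun i => hf.mulN_reducedField (hc i))
    (unitN (realization x))
  rw [mulRightN_apply, mulN_unitN] at hupdate
  rw [hupdate, mulRightN_apply, realization_mulN]

lemma stages_eventuallyEq_mulRightN (hf : IsLiftOn f g U) (hU : IsOpen U)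
    (hg : ContDiffOn ℝ 1 g U) (hW : IsOpen W)
    (hI : T.IsIntegrator h f (realization ⁻¹' U) (realization ⁻¹' W) Y)
    (hx : x ∈ realization ⁻¹' W) {c : SpaceP n m → Fin s → SpaceN n m}
    (hc : ContinuousAt c (realization x)) (hcx : mulRightN x ∘ c (realization x) = Y x)
    (hsol : ∀ᶠ y in 𝓝 (realization x),
      stageResidual (h • T.stageLin) (reducedField g y) (c y) = fun _ => unitN y) :
    Y =ᶠ[𝓝 x] fun x' => mulRightN x' ∘ c (realization x') := by
  have hΩ := hU.preimage (continuous_realization (n := n) (m := m))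
  have hWN := hW.preimage (continuous_realization (n := n) (m := m))
  have htendsto : Tendsto (fun x' => mulRightN x' ∘ c (realization x')) (𝓝 x) (𝓝 (Y x)) :=
    hcx ▸ (continuousAt_mulRightN_comp hc).tendsto
  have hmem : ∀ᶠ x' in 𝓝 x, ∀ i, mulN (c (realization x') i) x' ∈ realization ⁻¹' U :=
    eventually_all.2 fun i => (tendsto_pi_nhds.1 htendsto i).eventually
      (hΩ.mem_nhds (hI.mem_domain x hx i))
  refine eventuallyEq_of_comp_eventuallyEq
    (contDiffAt_stageResidual (hI.contDiffAt_vectorField hΩ (hf.contDiffOn hg) hx))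
    (hI.bijective_fderiv_stageResidual hx) (hI.continuousOn.continuousAt (hWN.mem_nhds hx))
    htendsto ?_
  filter_upwards [hI.stageResidual_eventuallyEq hWN hx, hmem,
    continuous_realization.continuousAt.eventually hsol] with x' hYx' hmemx' hsolx'
  rw [hYx', Function.comp_apply, hf.stageResidual_mulRightN hmemx' hsolx']

theorem exists_contDiffAt_comp_realization_eventuallyEq (hf : IsLiftOn f g U) (hU : IsOpen U)
    {r : WithTop ℕ∞} (hr : 1 ≤ r) (hg : ContDiffOn ℝ r g U) (hW : IsOpen W)
    (hI : T.IsIntegrator h f (realization ⁻¹' U) (realization ⁻¹' W) Y)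
    (hx : x ∈ realization ⁻¹' W) :
    ∃ κ : SpaceP n m → SpaceP n m, ContDiffAt ℝ r κ (realization x) ∧
      κ ∘ realization =ᶠ[𝓝 x] realization ∘ fun x => T.update h f x (Y x) := by
  obtain ⟨c₀, hc₀, hsol₀, hreg⟩ := hf.exists_reducedStages hU (hg.of_le hr) hI hx
  have hgc (i : Fin s) : ContDiffAt ℝ r (Function.uncurry (reducedField g))
      (realization x, c₀ i) := by
    refine contDiffAt_reducedField (hg.contDiffAt (hU.mem_nhds ?_))
    rw [← realization_mulN, ← mulRightN_apply, ← Function.comp_apply (f := mulRightN x), hc₀]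
    exact hI.mem_domain x hx i
  obtain ⟨c, rfl, hc, hsol⟩ := exists_contDiffAt_stages (zero_lt_one.trans_le hr).ne' hgc
    (contDiffAt_pi.2 fun _ => contDiff_unitN.contDiffAt) hsol₀ hreg
  have hY := hf.stages_eventuallyEq_mulRightN hU (hg.of_le hr) hW hI hx hc.continuousAt hc₀ hsol
  refine ⟨fun y => conjP (T.update h (reducedField g y) (unitN y) (c y)) y, ?_, ?_⟩
  · simp only [T.update_eq]
    exact contDiff_conjP.contDiffAt.comp (f := fun y =>
      (unitN y + h • T.updateLin (reducedField g y ∘ c y), y)) _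
      ((contDiff_unitN.contDiffAt.add ((T.updateLin.contDiff.contDiffAt.comp _
        (contDiffAt_uncurry_comp_pi hgc hc)).const_smul h)).prodMk contDiffAt_id)
  · filter_upwards [hY, (hW.preimage continuous_realization).mem_nhds hx] with x' hYx' hx'
    have hmem : ∀ i, (mulRightN x' ∘ c (realization x')) i ∈ realization ⁻¹' U :=
      hYx' ▸ hI.mem_domain x' hx'
    rw [Function.comp_apply, Function.comp_apply, hYx', hf.realization_update_mulRightN hmem]

end IsLiftOn

lemma isLiftOn_hamVectorField {H : SpaceP n m → ℝ} {U : Set (SpaceP n m)} (hU : IsOpen U)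
    (hH : DifferentiableOn ℝ H U) : IsLiftOn (hamVectorField (H ∘ realization))
      (fun y => imagN (coeffP (fderiv ℝ H y))) U := fun _ hx =>
  hamVectorField_comp_realization (hH.differentiableAt (hU.mem_nhds hx))

lemma contDiffOn_imagN_coeffP_fderiv {H : SpaceP n m → ℝ} {U : Set (SpaceP n m)} {r : WithTop ℕ∞}
    (hU : IsOpen U) (hH : ContDiffOn ℝ (r + 1) H U) :
    ContDiffOn ℝ r (fun y => imagN (coeffP (fderiv ℝ H y))) U :=
  (contDiff_imagN.comp coeffP.contDiff).comp_contDiffOn (hH.fderiv_of_isOpen hU le_rfl)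

end CollectiveSymplectic

end

theorem mainTheorem1_general (n m s : ℕ) (T : PRKMethod s)
    (hz : T.tz.IsSymplectic) (hpq : IsSymplecticPair T.tp T.tq)
    (hb : ∀ i, T.tz.b i = T.tq.b i) (r : WithTop ℕ∞) (hr : 1 ≤ r) :
    (∀ (Ω : Set (SpaceN n m)) (K : SpaceN n m → ℝ),
      IsOpen Ω → ContDiffOn ℝ (r + 1) K Ω →
      ∀ (h : ℝ) (V : Set (SpaceN n m)) (Y : SpaceN n m → Fin s → SpaceN n m),
        IsOpen V → T.IsIntegrator h (hamVectorField K) Ω V Y →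
        ContDiffOn ℝ r (fun x => T.update h (hamVectorField K) x (Y x)) V ∧
        IsSymplecticOnN (fun x => T.update h (hamVectorField K) x (Y x)) V) ∧
    (∀ (U : Set (SpaceP n m)) (H : SpaceP n m → ℝ),
      IsOpen U → ContDiffOn ℝ (r + 1) H U →
      (∀ C : Set (SpaceP n m), IsCompact C → C ⊆ U → ∀ ε > 0, ∃ h₀ > 0, ∀ h : ℝ, |h| < h₀ →
        ∃ (W : Set (SpaceP n m)) (Y : SpaceN n m → Fin s → SpaceN n m),
          IsOpen W ∧ C ⊆ W ∧
          T.IsIntegrator h (hamVectorField (H ∘ realization))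
            (realization ⁻¹' U) (realization ⁻¹' W) Y ∧
          ∀ x ∈ realization ⁻¹' W, ∀ i, dist (Y x i) x < ε) ∧
      (∀ (h : ℝ) (W : Set (SpaceP n m)) (Y : SpaceN n m → Fin s → SpaceN n m),
        IsOpen W →
        T.IsIntegrator h (hamVectorField (H ∘ realization))
          (realization ⁻¹' U) (realization ⁻¹' W) Y →
        ∃ φ : SpaceP n m → SpaceP n m,
          (∀ x ∈ realization ⁻¹' W, φ (realization x) =
            realization (T.update h (hamVectorField (H ∘ realization)) x (Y x))) ∧
          ContDiffOn ℝ r φ W ∧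
          IsPoissonOnP φ W ∧ PreservesLeavesOn φ W ∧ RestrictsToSymplecticOnM φ W)) := by
  have hr0 : r ≠ 0 := (zero_lt_one.trans_le hr).ne'
  have hr2 : 2 ≤ r + 1 := one_add_one_eq_two.symm.trans_le (add_le_add_left hr 1)
  refine ⟨fun Ω K hΩ hK h V Y hV hI => ⟨fun x hx => (hI.contDiffAt_update hΩ hV hr0
    (contDiffOn_hamVectorField hΩ hK) hx).contDiffWithinAt,
      hI.isSymplecticOnN hz hpq hb hΩ (hK.of_le hr2) hV⟩, fun U H hU hH => ?_⟩
  have hΩ : IsOpen (realization (n := n) (m := m) ⁻¹' U) := hU.preimage continuous_realization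
  have hK : ContDiffOn ℝ (r + 1) (H ∘ realization) (realization (n := n) (m := m) ⁻¹' U) :=
    hH.comp contDiff_realization.contDiffOn (Set.mapsTo_preimage _ _)
  have hf : ContDiffOn ℝ 1 _ _ := (contDiffOn_hamVectorField hΩ hK).of_le hr
  refine ⟨fun C hC hCU ε hε => T.exists_isIntegrator_preimage hU hf hC hCU hε,
    fun h W Y hW hI => ?_⟩
  have hlift := isLiftOn_hamVectorField hU (hH.differentiableOn (zero_lt_two.trans_le hr2).ne')
  obtain ⟨φ, hφ⟩ := exists_descendsOn fun x hx x' hxx' =>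
    hlift.isTorusEquivariantOn.realization_update_eq hU hf hI hx hxx'
  have hφr : ContDiffOn ℝ r φ W := hφ.contDiffOn hW fun x hx =>
    hlift.exists_contDiffAt_comp_realization_eventuallyEq hU hr
      (contDiffOn_imagN_coeffP_fderiv hU hH) hW hI hx
  have hφ' : ∀ y ∈ W, DifferentiableAt ℝ φ y := fun y hy =>
    (hφr.contDiffAt (hW.mem_nhds hy)).differentiableAt hr0
  have hΦ := hI.isSymplecticOnN hz hpq hb hΩ (hK.of_le hr2) (hW.preimage continuous_realization)
  have hleaf : PreservesLeavesOn φ W := hφ.preservesLeavesOn fun x hx =>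
    hI.normSq_update hz (fun x hx => ⟨_, hlift x hx⟩) hx
  exact ⟨φ, hφ, hφr, hφ.isPoissonOnP hW hφ' hΦ, hleaf,
    hφ.restrictsToSymplecticOnM hW hφ' hΦ hleaf⟩

theorem mainTheorem1 (n m s : ℕ) (T : PRKMethod s)
    (hz : T.tz.IsSymplectic) (hpq : IsSymplecticPair T.tp T.tq)
    (hb : ∀ i, T.tz.b i = T.tq.b i) (r : ℕ∞) (hr : 1 ≤ r) :
    -- the integrator is symplectic on `N`
    (∀ (Ω : Set (SpaceN n m)) (K : SpaceN n m → ℝ),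
      IsOpen Ω → ContDiffOn ℝ ((r : WithTop ℕ∞) + 1) K Ω →
      ∀ (h : ℝ) (V : Set (SpaceN n m)) (Y : SpaceN n m → Fin s → SpaceN n m),
        IsOpen V → T.IsIntegrator h (hamVectorField K) Ω V Y →
        ContDiffOn ℝ (r : WithTop ℕ∞) (fun x => T.update h (hamVectorField K) x (Y x)) V ∧
        IsSymplecticOnN (fun x => T.update h (hamVectorField K) x (Y x)) V) ∧
    -- for the pull-back of a Hamiltonian on `P`:
    (∀ (U : Set (SpaceP n m)) (H : SpaceP n m → ℝ),
      IsOpen U → ContDiffOn ℝ ((r : WithTop ℕ∞) + 1) H U →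
      -- the integrator exists near compact sets if the step is small
      (∀ C : Set (SpaceP n m), IsCompact C → C ⊆ U → ∀ ε > 0, ∃ h₀ > 0, ∀ h : ℝ, |h| < h₀ →
        ∃ (W : Set (SpaceP n m)) (Y : SpaceN n m → Fin s → SpaceN n m),
          IsOpen W ∧ C ⊆ W ∧
          T.IsIntegrator h (hamVectorField (H ∘ realization))
            (realization ⁻¹' U) (realization ⁻¹' W) Y ∧
          ∀ x ∈ realization ⁻¹' W, ∀ i, dist (Y x i) x < ε) ∧
      -- it descends to a Poisson integrator on `P`, which restricts to a symplectic one on `M`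
      (∀ (h : ℝ) (W : Set (SpaceP n m)) (Y : SpaceN n m → Fin s → SpaceN n m),
        IsOpen W →
        T.IsIntegrator h (hamVectorField (H ∘ realization))
          (realization ⁻¹' U) (realization ⁻¹' W) Y →
        ∃ φ : SpaceP n m → SpaceP n m,
          (∀ x ∈ realization ⁻¹' W, φ (realization x) =
            realization (T.update h (hamVectorField (H ∘ realization)) x (Y x))) ∧
          ContDiffOn ℝ (r : WithTop ℕ∞) φ W ∧
          IsPoissonOnP φ W ∧ PreservesLeavesOn φ W ∧ RestrictsToSymplecticOnM φ W)) :=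
  mainTheorem1_general n m s T hz hpq hb r (by exact_mod_cast hr)
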